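/- **Theorem (Conservative model extension).** *Setting.* Terms are simply typed $\lambda$-terms (modulo $\alpha$) over non-logical constants from a signature $\Sigma$, with fixed-point terms $\mathit{fix}\,\lambda x.M$ (where $\mathit{fix}\,\lambda x.M:\tau$ if $M:\tau$ for $x:\tau$) and the logical constants $\top,\land,\lor,\supset,\forall_\tau,\exists_\tau$. Terms and formulae are taken in $\beta$-normal form. Let $=_{\mathit{fix}\beta}$ be the congruence generated by $(\lambda x.M)N\to M[x:=N]$ and $\mathit{fix}\,\lambda x.M\to M[x:=\mathit{fix}\,\lambda x.M]$. The signature $\Sigma$ is first-order: each of its constants is a function symbol $\iota\to\cdots\to\iota\to\iota$ or a predicate symbol $\iota\to\cdots\to\iota\to o$; it contains at least one function symbol (possibly of arity $0$), i.e. the set $\mathcal H^\Sigma$ of all finite and infinite closed tree-terms over $\Sigma$ is non-empty. $\mathcal B^\Sigma$ is the set of all finite and infinite closed tree-atoms over $\Sigma$. An *$H$-formula* is a closed formula $\forall_\iota x_1\ldots x_m\,(A_1\land\dots\land A_n\supset A)$, $m,n\ge 0$, with atoms that are headed by non-logical constants and contain neither $\forall$ nor $\supset$; a *logic program* is a finite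 set of $H$-formulae. A *guarded fixed point term* is a term $\mathit{fix}\,\lambda x.\lambda y_1\ldots y_m.\,f\,L_1\ldots L_k\,(x\,N_1\ldots N_m)\,L_{k+1}\ldots L_r$ with $m,r\ge 0$, $f$ a function symbol of arity $r+1$, and $L_i,N_j$ first-order terms of type $\iota$ not containing $x$ whose free variables together are exactly $y_1,\dots,y_m$. A *guarded full term* is a first-order term, or such a fixed point term applied to $m$ first-order terms. An atom is *guarded* if it is $=_{\mathit{fix}\beta}$ to some $h\,M_1\ldots M_n$ with $h$ a first-order predicate symbol and all $M_i$ guarded full terms. For a guarded atom $A$, $A^T$ denotes the (possibly infinite) tree-atom to which it unfolds under $=_{\mathit{fix}\beta}$, that is, the limit in the tree metric of the first-order parts of the terms equivalent to $A$. *Proofs.* *co-hohh* is the calculus with clauses $D::=A_r\mid G\supset D\mid D\land D\mid\forall x\,D$ and goals $G::=\top\mid A\mid G\land G\mid G\lor G\mid\exists x\,G\mid D\supset G\mid\forall x\,G$ ($A$ atoms, $A_r$ atoms headed by a non-logical constant, no atom containing $\supset$), with the uniform proof rules for $\Sigma;P\longrightarrow G$ and $\Sigma;P\stackrel{D}{\longrightarrow}A$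 (right rules for all connectives and quantifiers, left rules for $\supset,\land,\forall$, *decide*, and *initial* modulo $=_{\mathit{fix}\beta}$; $\exists$ on the right and $\forall$ on the left are instantiated by closed $\supset$-free terms, and $\forall$ on the right by a fresh constant), together with the rule *co-fix*, which infers $\Sigma;P\looparrowright M$ from $\Sigma;P,M\longrightarrow\langle M\rangle$. Guarded goals $\langle\cdot\rangle$ have analogous rules for $\supset,\forall,\land$ on the right, which keep the guard, and for *decide*, restricted to clauses of the original program $P$; with a guarded atom $\langle A\rangle$ on the right, $\land$ and $\forall$ on the left keep the guard, *initial* is available, and $\supset$ on the left infers $\Sigma;P\stackrel{G\supset D}{\longrightarrow}\langle A\rangle$ from the unguarded sequents $\Sigma;P\stackrel{D}{\longrightarrow}A$ and $\Sigma;P\longrightarrow G$. *Models.* For a program $P$ of $H$-formulae with guarded atoms, let $\mathcal T_P(I)$, $I\subseteq\mathcal B^\Sigma$, be the set of all $B\in\mathcal B^\Sigma$ such that some $\forall_\iota x_1\ldots x_m\,(A_1\land\dots\land A_n\supset A)\in P$ and some $N_1,\dots,N_m\in\mathcal H^\Sigma$ satisfy $A^T[\bar x:=\bar N]=B$ and $A_i^T[\bar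 x:=\bar N]\in I$ for all $i$. The *coinductive model* of $P$ is the greatest fixed point of $\mathcal T_P$. *Statement.* Let $P$ be a logic program over $\Sigma$ with coinductive model $\mathcal M$, let $H$ be an $H$-formula over $\Sigma$, and suppose that $\Sigma;P\looparrowright H$ has a *co-hohh* proof in which all atoms of all formulae are guarded. Let $H_1,\dots,H_n$ be distinct term-form ground instances of $H$ (the variables $x_1,\dots,x_m$ of $H$ are replaced by closed terms of type $\iota$ over $\Sigma$ containing neither $\forall$ nor $\supset$) all of whose atoms are guarded, such that $A^T\in\mathcal M$ for every body atom $A$ of every $H_k$. Then the coinductive model $\mathcal M'$ of $P\cup\{H_1,\dots,H_n\}$ equals $\mathcal M$. -/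

import Mathlib

namespace CUP

/-! ### Simple types, terms, typing -/

/-- Simple types over countably many type variables, among them `o` and `iota`. -/
inductive Ty : Type
  | o : Ty
  | iota : Ty
  | base : ℕ → Ty
  | arr : Ty → Ty → Ty

/-- The type `iota → ⋯ → iota → τ` with `k` argument types. -/
def Ty.arrows : ℕ → Ty → Ty
  | 0, τ => τ
  | k + 1, τ => Ty.arr Ty.iota (Ty.arrows k τ)

/-- The logical constants. -/
inductive LCon : Type
  | top : LCon
  | and : LCon
  | or : LCon
  | imp : LCon
  | all : Ty → LCon
  | ex : Ty → LCon

/-- The types of the logical constants. -/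
def LCon.ty : LCon → Ty
  | .top => .o
  | .and => .arr .o (.arr .o .o)
  | .or => .arr .o (.arr .o .o)
  | .imp => .arr .o (.arr .o .o)
  | .all τ => .arr (.arr τ .o) .o
  | .ex τ => .arr (.arr τ .o) .o

/-- Lambda terms modulo α-equivalence, in de Bruijn notation. The non-logical constants are the
natural numbers. `lam M` is `λ x. M` and `fix M` is `fix λ x. M`; both bind index `0` in `M`. -/
inductive Tm : Type
  | var : ℕ → Tm
  | cst : ℕ → Tm
  | log : LCon → Tm
  | app : Tm → Tm → Tm
  | lam : Tm → Tm
  | fix : Tm → Tm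

/-- A signature: a partial function from non-logical constants to types. (All logical constants
are always available, with their fixed types.) -/
abbrev Sig : Type := ℕ → Option Ty

/-- A first-order signature: every non-logical constant is a function symbol
`iota → ⋯ → iota → iota` or a predicate symbol `iota → ⋯ → iota → o`. -/
def Sig.FirstOrder (S : Sig) : Prop :=
  ∀ c τ, S c = some τ → ∃ k, τ = Ty.arrows k .iota ∨ τ = Ty.arrows k .o

/-- The typing judgement `S, Γ ⊢ M : τ`. -/
inductive HasType (S : Sig) : List Ty → Tm → Ty → Prop
  | var {Γ : List Ty} {i : ℕ} {τ : Ty} : Γ[i]? = some τ → HasType S Γ (.var i) τ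
  | con {Γ : List Ty} {c : ℕ} {τ : Ty} : S c = some τ → HasType S Γ (.cst c) τ
  | log {Γ : List Ty} {l : LCon} : HasType S Γ (.log l) l.ty
  | app {Γ : List Ty} {M N : Tm} {σ τ : Ty} :
      HasType S Γ M (.arr σ τ) → HasType S Γ N σ → HasType S Γ (.app M N) τ
  | abs {Γ : List Ty} {M : Tm} {σ τ : Ty} :
      HasType S (σ :: Γ) M τ → HasType S Γ (.lam M) (.arr σ τ)
  | fp {Γ : List Ty} {M : Tm} {τ : Ty} :
      HasType S (τ :: Γ) M τ → HasType S Γ (.fix M) τ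

namespace Tm

/-- Lifting of a renaming under a binder. -/
def upRen (ρ : ℕ → ℕ) : ℕ → ℕ
  | 0 => 0
  | i + 1 => ρ i + 1

/-- Renaming of free variables. -/
def rename : (ℕ → ℕ) → Tm → Tm
  | ρ, var i => var (ρ i)
  | _, cst c => cst c
  | _, log l => log l
  | ρ, app M N => app (rename ρ M) (rename ρ N)
  | ρ, lam M => lam (rename (upRen ρ) M)
  | ρ, fix M => fix (rename (upRen ρ) M)

/-- Lifting of a substitution under a binder. -/
def up (σ : ℕ → Tm) : ℕ → Tm
  | 0 => var 0
  | i + 1 => rename Nat.succ (σ i)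

/-- Simultaneous capture-avoiding substitution. -/
def subst : (ℕ → Tm) → Tm → Tm
  | σ, var i => σ i
  | _, cst c => cst c
  | _, log l => log l
  | σ, app M N => app (subst σ M) (subst σ N)
  | σ, lam M => lam (subst (up σ) M)
  | σ, fix M => fix (subst (up σ) M)

/-- `M[x := N]`, where `x` is the variable with index `0` of `M`. -/
def inst (M N : Tm) : Tm :=
  subst (fun i => match i with
    | 0 => N
    | i + 1 => var i) M

/-- The free variables of a term, as a set of de Bruijn indices. -/
def fv : Tm → Set ℕ
  | var i => {i}
  | cst _ => ∅
  | log _ => ∅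
  | app M N => fv M ∪ fv N
  | lam M => {i | i + 1 ∈ fv M}
  | fix M => {i | i + 1 ∈ fv M}

/-- `h M₁ … Mₙ`. -/
def apps (h : Tm) (Ms : List Tm) : Tm := Ms.foldl app h

/-- `λ y₁ … yₘ. M`. -/
def lams : ℕ → Tm → Tm
  | 0, M => M
  | m + 1, M => lam (lams m M)

/-- The head `h` of a term written as `h M₁ … Mₙ` with `h` not an application. -/
def head : Tm → Tm
  | app M _ => head M
  | M => M

/-- The arguments `M₁, …, Mₙ` of a term written as `h M₁ … Mₙ` with `h` not an application. -/
def args : Tm → List Tm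
  | app M N => args M ++ [N]
  | _ => []

/-- No logical constant satisfying `bad` occurs in the term. -/
def Avoids (bad : LCon → Prop) : Tm → Prop
  | var _ => True
  | cst _ => True
  | log l => ¬ bad l
  | app M N => Avoids bad M ∧ Avoids bad N
  | lam M => Avoids bad M
  | fix M => Avoids bad M

/-- Terms that contain neither `∀` nor `⊃`. -/
def InU1 (M : Tm) : Prop := M.Avoids (fun l => l = .imp ∨ ∃ τ, l = .all τ)

/-- Terms that do not contain `⊃`. -/
def InU2 (M : Tm) : Prop := M.Avoids (fun l => l = .imp)

/-- One step β-reduction. -/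
inductive BetaStep : Tm → Tm → Prop
  | beta (M N : Tm) : BetaStep (app (lam M) N) (inst M N)
  | appL {M N : Tm} (L : Tm) : BetaStep M N → BetaStep (app M L) (app N L)
  | appR {M N : Tm} (L : Tm) : BetaStep M N → BetaStep (app L M) (app L N)
  | lam {M N : Tm} : BetaStep M N → BetaStep (lam M) (lam N)
  | fix {M N : Tm} : BetaStep M N → BetaStep (fix M) (fix N)

/-- One step `fix`β-reduction. -/
inductive FixStep : Tm → Tm → Prop
  | unfold (M : Tm) : FixStep (fix M) (inst M (fix M))
  | appL {M N : Tm} (L : Tm) : FixStep M N → FixStep (app M L) (app N L)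
  | appR {M N : Tm} (L : Tm) : FixStep M N → FixStep (app L M) (app L N)
  | lam {M N : Tm} : FixStep M N → FixStep (lam M) (lam N)
  | fix {M N : Tm} : FixStep M N → FixStep (fix M) (fix N)

/-- β-normal terms. -/
def BetaNormal (M : Tm) : Prop := ∀ N, ¬ BetaStep M N

/-- `fix`β-equivalence. -/
def FixBetaEq : Tm → Tm → Prop :=
  Relation.EqvGen (fun M N => BetaStep M N ∨ FixStep M N)

/-- `N` is the β-normal form of `M`. -/
def BetaNF (M N : Tm) : Prop := Relation.ReflTransGen BetaStep M N ∧ BetaNormal N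

/-! ### Formulae -/

abbrev tt : Tm := log .top
abbrev conj (F G : Tm) : Tm := app (app (log .and) F) G
abbrev disj (F G : Tm) : Tm := app (app (log .or) F) G
abbrev impl (F G : Tm) : Tm := app (app (log .imp) F) G
/-- `∀ x : τ, F`, binding index `0` of `F`. -/
abbrev all (τ : Ty) (F : Tm) : Tm := app (log (.all τ)) (lam F)
/-- `∃ x : τ, F`, binding index `0` of `F`. -/
abbrev ex (τ : Ty) (F : Tm) : Tm := app (log (.ex τ)) (lam F)

/-- Rigid atoms (among terms of type `o`): the head is a non-logical constant. -/
def IsRigid (A : Tm) : Prop := ∃ (c : ℕ) (Ms : List Tm), A = apps (cst c) Ms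

/-- Atoms (among terms of type `o`): the head is a variable or a non-logical constant. -/
def IsAtomic (A : Tm) : Prop := IsRigid A ∨ ∃ (i : ℕ) (Ms : List Tm), A = apps (var i) Ms

mutual

/-- The program clauses of *co-hohh*:
`D ::= A_r | G ⊃ D | D ∧ D | ∀ x, D` with atoms that do not contain `⊃`. -/
inductive IsD : Tm → Prop
  | atom {A : Tm} : IsRigid A → InU2 A → IsD A
  | imp {G D : Tm} : IsG G → IsD D → IsD (impl G D)
  | and {D E : Tm} : IsD D → IsD E → IsD (conj D E)
  | all {τ : Ty} {D : Tm} : IsD D → IsD (all τ D)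

/-- The goals of *co-hohh*:
`G ::= ⊤ | A | G ∧ G | G ∨ G | ∃ x, G | D ⊃ G | ∀ x, G` with atoms that do not contain `⊃`. -/
inductive IsG : Tm → Prop
  | top : IsG tt
  | atom {A : Tm} : IsAtomic A → InU2 A → IsG A
  | and {F G : Tm} : IsG F → IsG G → IsG (conj F G)
  | or {F G : Tm} : IsG F → IsG G → IsG (disj F G)
  | ex {τ : Ty} {G : Tm} : IsG G → IsG (ex τ G)
  | imp {D G : Tm} : IsD D → IsG G → IsG (impl D G)
  | all {τ : Ty} {G : Tm} : IsG G → IsG (all τ G)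

end

/-- `AtomOf A F`: the atom `A` occurs in the formula `F` as an atomic subformula. -/
inductive AtomOf (A : Tm) : Tm → Prop
  | self : IsAtomic A → AtomOf A A
  | andL {F : Tm} (G : Tm) : AtomOf A F → AtomOf A (conj F G)
  | andR (F : Tm) {G : Tm} : AtomOf A G → AtomOf A (conj F G)
  | orL {F : Tm} (G : Tm) : AtomOf A F → AtomOf A (disj F G)
  | orR (F : Tm) {G : Tm} : AtomOf A G → AtomOf A (disj F G)
  | impL {F : Tm} (G : Tm) : AtomOf A F → AtomOf A (impl F G)
  | impR (F : Tm) {G : Tm} : AtomOf A G → AtomOf A (impl F G)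
  | all {τ : Ty} {F : Tm} : AtomOf A F → AtomOf A (all τ F)
  | ex {τ : Ty} {F : Tm} : AtomOf A F → AtomOf A (ex τ F)

/-! ### Guarded terms and atoms -/

/-- First-order terms of type `iota` over `S` (all variables are of type `iota`). -/
inductive FOTerm (S : Sig) : Tm → Prop
  | var (i : ℕ) : FOTerm S (var i)
  | fn (f : ℕ) (Ms : List Tm) : S f = some (Ty.arrows Ms.length .iota) →
      (∀ M ∈ Ms, FOTerm S M) → FOTerm S (apps (cst f) Ms)

/-- Guarded fixed point terms
`fix λ x. λ y₁ … yₘ. f L₁ … Lₖ (x N₁ … Nₘ) Lₖ₊₁ … Lᵣ` of type `iota → ⋯ → iota → iota`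
with `m` arguments. Below the binders `y₁, …, yₘ` are the indices `m - 1, …, 0`, and `x` is the
index `m`. The free variables of the `Lᵢ` and `Nᵢ` together are exactly `y₁, …, yₘ`. -/
def GuardedFix (S : Sig) (m : ℕ) (F : Tm) : Prop :=
  ∃ (f : ℕ) (Ls Ls' Ns : List Tm),
    Ns.length = m ∧
    S f = some (Ty.arrows (Ls.length + 1 + Ls'.length) .iota) ∧
    (∀ M ∈ Ls ++ Ls' ++ Ns, FOTerm S M) ∧
    (∀ i, (∃ M ∈ Ls ++ Ls' ++ Ns, i ∈ M.fv) ↔ i < m) ∧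
    F = fix (lams m (apps (cst f) (Ls ++ [apps (var m) Ns] ++ Ls')))

/-- Guarded full terms: first-order terms, and guarded fixed point terms applied to first-order
terms. -/
def GuardedFull (S : Sig) (M : Tm) : Prop :=
  FOTerm S M ∨ ∃ (F : Tm) (Ms : List Tm),
    GuardedFix S Ms.length F ∧ (∀ N ∈ Ms, FOTerm S N) ∧ M = apps F Ms

/-- Guarded atoms: the atoms `fix`β-equivalent to some `h M₁ … Mₙ`, where `h` is a first-order
predicate and the `Mᵢ` are guarded full terms. -/
def GuardedAtom (S : Sig) (A : Tm) : Prop :=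
  IsAtomic A ∧ ∃ (h : ℕ) (Ms : List Tm),
    S h = some (Ty.arrows Ms.length .o) ∧ (∀ M ∈ Ms, GuardedFull S M) ∧
    FixBetaEq A (apps (cst h) Ms)

end Tm

/-! ### Coinductive uniform proofs -/

/-- Sequents, relative to an original program `P` that stays fixed throughout a proof; `Δ` is the
set of formulae that were added to it. -/
inductive Sequent : Type
  /-- `S; P, Δ ⟶ G` -/
  | goal (S : Sig) (Δ : Set Tm) (G : Tm) : Sequent
  /-- `S; P, Δ ⟶ A` with `D` above the arrow -/
  | focus (S : Sig) (Δ : Set Tm) (D A : Tm) : Sequent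
  /-- `S; P, Δ ⟶ ⟨M⟩` -/
  | ggoal (S : Sig) (Δ : Set Tm) (M : Tm) : Sequent
  /-- `S; P, Δ ⟶ ⟨A⟩` with `D` above the arrow -/
  | gfocus (S : Sig) (Δ : Set Tm) (D A : Tm) : Sequent
  /-- `S; P ↬ M` -/
  | coind (S : Sig) (M : Tm) : Sequent

namespace Sequent

def sig : Sequent → Sig
  | goal S _ _ => S
  | focus S _ _ _ => S
  | ggoal S _ _ => S
  | gfocus S _ _ _ => S
  | coind S _ => S

/-- The formulae that occur as program clauses in a sequent. Guarded goals and coinductive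
goals are core formulae, that is, both clauses and goals. -/
def clauses (P : Set Tm) : Sequent → Set Tm
  | goal _ Δ _ => P ∪ Δ
  | focus _ Δ D _ => P ∪ Δ ∪ {D}
  | ggoal _ Δ M => P ∪ Δ ∪ {M}
  | gfocus _ Δ D A => P ∪ Δ ∪ {D, A}
  | coind _ M => P ∪ {M}

/-- The formula that occurs as a goal in a sequent. -/
def goalFormula : Sequent → Tm
  | goal _ _ G => G
  | focus _ _ _ A => A
  | ggoal _ _ M => M
  | gfocus _ _ _ A => A
  | coind _ M => M

/-- All formulae of the sequent are closed β-normal formulae over its signature that obey the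
syntax of *co-hohh*. -/
def InCoHohh (P : Set Tm) (s : Sequent) : Prop :=
  (∀ D ∈ s.clauses P, Tm.IsD D ∧ HasType s.sig [] D .o ∧ D.BetaNormal) ∧
  (Tm.IsG s.goalFormula ∧ HasType s.sig [] s.goalFormula .o ∧ s.goalFormula.BetaNormal)

/-- All atoms of the formulae of the sequent are guarded atoms over its signature. -/
def OnlyGuarded (P : Set Tm) (s : Sequent) : Prop :=
  (∀ D ∈ s.clauses P, ∀ A, Tm.AtomOf A D → Tm.GuardedAtom s.sig A) ∧
  (∀ A, Tm.AtomOf A s.goalFormula → Tm.GuardedAtom s.sig A)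

end Sequent

/-- The terms that may instantiate a quantifier of type `τ` in *co-hohh*. -/
def Witness (S : Sig) (τ : Ty) (N : Tm) : Prop :=
  HasType S [] N τ ∧ N.InU2 ∧ N.BetaNormal

open Tm in
/-- `Proof P Q s`: there is a finite proof tree for the sequent `s`, built with the coinductive
uniform proof rules of *co-hohh* from the original program `P`, all of whose sequents satisfy
`Q`. -/
inductive Proof (P : Set Tm) (Q : Sequent → Prop) : Sequent → Prop
  | impR {S : Sig} {Δ : Set Tm} {D G : Tm} : Q (.goal S Δ (impl D G)) →
      Proof P Q (.goal S (insert D Δ) G) → Proof P Q (.goal S Δ (impl D G))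
  | allR {S : Sig} {Δ : Set Tm} {τ : Ty} {G : Tm} (c : ℕ) : Q (.goal S Δ (all τ G)) →
      S c = none →
      Proof P Q (.goal (Function.update S c (some τ)) Δ (inst G (cst c))) →
      Proof P Q (.goal S Δ (all τ G))
  | exR {S : Sig} {Δ : Set Tm} {τ : Ty} {G G' : Tm} (N : Tm) : Q (.goal S Δ (ex τ G)) →
      Witness S τ N → BetaNF (inst G N) G' →
      Proof P Q (.goal S Δ G') → Proof P Q (.goal S Δ (ex τ G))
  | orR₁ {S : Sig} {Δ : Set Tm} {G₁ G₂ : Tm} : Q (.goal S Δ (disj G₁ G₂)) →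
      Proof P Q (.goal S Δ G₁) → Proof P Q (.goal S Δ (disj G₁ G₂))
  | orR₂ {S : Sig} {Δ : Set Tm} {G₁ G₂ : Tm} : Q (.goal S Δ (disj G₁ G₂)) →
      Proof P Q (.goal S Δ G₂) → Proof P Q (.goal S Δ (disj G₁ G₂))
  | andR {S : Sig} {Δ : Set Tm} {G₁ G₂ : Tm} : Q (.goal S Δ (conj G₁ G₂)) →
      Proof P Q (.goal S Δ G₁) → Proof P Q (.goal S Δ G₂) →
      Proof P Q (.goal S Δ (conj G₁ G₂))
  | topR {S : Sig} {Δ : Set Tm} : Q (.goal S Δ tt) → Proof P Q (.goal S Δ tt)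
  | decide {S : Sig} {Δ : Set Tm} {A : Tm} (D : Tm) : Q (.goal S Δ A) →
      IsAtomic A → D ∈ P ∪ Δ →
      Proof P Q (.focus S Δ D A) → Proof P Q (.goal S Δ A)
  | impL {S : Sig} {Δ : Set Tm} {G D A : Tm} : Q (.focus S Δ (impl G D) A) → IsAtomic A →
      Proof P Q (.focus S Δ D A) → Proof P Q (.goal S Δ G) →
      Proof P Q (.focus S Δ (impl G D) A)
  | andL₁ {S : Sig} {Δ : Set Tm} {D₁ D₂ A : Tm} : Q (.focus S Δ (conj D₁ D₂) A) → IsAtomic A →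
      Proof P Q (.focus S Δ D₁ A) → Proof P Q (.focus S Δ (conj D₁ D₂) A)
  | andL₂ {S : Sig} {Δ : Set Tm} {D₁ D₂ A : Tm} : Q (.focus S Δ (conj D₁ D₂) A) → IsAtomic A →
      Proof P Q (.focus S Δ D₂ A) → Proof P Q (.focus S Δ (conj D₁ D₂) A)
  | allL {S : Sig} {Δ : Set Tm} {τ : Ty} {D D' A : Tm} (N : Tm) : Q (.focus S Δ (all τ D) A) →
      IsAtomic A → Witness S τ N → BetaNF (inst D N) D' →
      Proof P Q (.focus S Δ D' A) → Proof P Q (.focus S Δ (all τ D) A)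
  | initial {S : Sig} {Δ : Set Tm} {A' A : Tm} : Q (.focus S Δ A' A) →
      IsAtomic A' → IsAtomic A → FixBetaEq A A' → Proof P Q (.focus S Δ A' A)
  | cofix {S : Sig} {M : Tm} : Q (.coind S M) →
      Proof P Q (.ggoal S {M} M) → Proof P Q (.coind S M)
  | gimpR {S : Sig} {Δ : Set Tm} {M₁ M₂ : Tm} : Q (.ggoal S Δ (impl M₁ M₂)) →
      Proof P Q (.ggoal S (insert M₁ Δ) M₂) → Proof P Q (.ggoal S Δ (impl M₁ M₂))
  | gallR {S : Sig} {Δ : Set Tm} {τ : Ty} {M : Tm} (c : ℕ) : Q (.ggoal S Δ (all τ M)) →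
      S c = none →
      Proof P Q (.ggoal (Function.update S c (some τ)) Δ (inst M (cst c))) →
      Proof P Q (.ggoal S Δ (all τ M))
  | gandR {S : Sig} {Δ : Set Tm} {M₁ M₂ : Tm} : Q (.ggoal S Δ (conj M₁ M₂)) →
      Proof P Q (.ggoal S Δ M₁) → Proof P Q (.ggoal S Δ M₂) →
      Proof P Q (.ggoal S Δ (conj M₁ M₂))
  | gimpL {S : Sig} {Δ : Set Tm} {G D A : Tm} : Q (.gfocus S Δ (impl G D) A) → IsAtomic A →
      Proof P Q (.focus S Δ D A) → Proof P Q (.goal S Δ G) →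
      Proof P Q (.gfocus S Δ (impl G D) A)
  | gandL₁ {S : Sig} {Δ : Set Tm} {D₁ D₂ A : Tm} : Q (.gfocus S Δ (conj D₁ D₂) A) →
      IsAtomic A → Proof P Q (.gfocus S Δ D₁ A) → Proof P Q (.gfocus S Δ (conj D₁ D₂) A)
  | gandL₂ {S : Sig} {Δ : Set Tm} {D₁ D₂ A : Tm} : Q (.gfocus S Δ (conj D₁ D₂) A) →
      IsAtomic A → Proof P Q (.gfocus S Δ D₂ A) → Proof P Q (.gfocus S Δ (conj D₁ D₂) A)
  | gallL {S : Sig} {Δ : Set Tm} {τ : Ty} {D D' A : Tm} (N : Tm) :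
      Q (.gfocus S Δ (all τ D) A) → IsAtomic A → Witness S τ N → BetaNF (inst D N) D' →
      Proof P Q (.gfocus S Δ D' A) → Proof P Q (.gfocus S Δ (all τ D) A)
  /-- Only clauses of the original program may be selected while the goal is guarded. -/
  | gdecide {S : Sig} {Δ : Set Tm} {A : Tm} (D : Tm) : Q (.ggoal S Δ A) →
      IsAtomic A → D ∈ P →
      Proof P Q (.gfocus S Δ D A) → Proof P Q (.ggoal S Δ A)
  | ginitial {S : Sig} {Δ : Set Tm} {A' A : Tm} : Q (.gfocus S Δ A' A) →
      IsAtomic A' → IsAtomic A → FixBetaEq A A' → Proof P Q (.gfocus S Δ A' A)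

/-- `S; P ↬ M` has a *co-hohh* proof that involves only guarded atoms. -/
def GuardedCoHohhProvable (S : Sig) (P : Set Tm) (M : Tm) : Prop :=
  Proof P (fun s => s.InCoHohh P ∧ s.OnlyGuarded P) (.coind S M)

/-! ### H-formulae -/

/-- The data of an H-formula `∀ x₁ … xₘ : iota, A₁ ∧ ⋯ ∧ Aₙ ⊃ A`. -/
structure HFormula : Type where
  /-- the number `m` of universal quantifiers; the atoms have free indices `< m` -/
  arity : ℕ
  /-- `A₁, …, Aₙ` -/
  body : List Tm
  /-- `A` -/
  head : Tm

/-- `A₁ ∧ ⋯ ∧ Aₙ`, nested to the right. (The empty conjunction is not used.) -/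
def conjs : List Tm → Tm
  | [] => Tm.tt
  | [A] => A
  | A :: B :: As => Tm.conj A (conjs (B :: As))

/-- `∀ x₁ … xₘ : iota, F`. -/
def alls : ℕ → Tm → Tm
  | 0, F => F
  | m + 1, F => Tm.all .iota (alls m F)

namespace HFormula

/-- The formula `A₁ ∧ ⋯ ∧ Aₙ ⊃ A`, which is just `A` if `n = 0`. -/
def matrix (K : HFormula) : Tm :=
  match K.body with
  | [] => K.head
  | A :: As => Tm.impl (conjs (A :: As)) K.head

def toFormula (K : HFormula) : Tm := alls K.arity K.matrix

def atoms (K : HFormula) : List Tm := K.head :: K.body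

/-- `K` is an H-formula over `S`: its atoms are well-typed β-normal rigid atoms containing
neither `∀` nor `⊃`. -/
def WellFormed (S : Sig) (K : HFormula) : Prop :=
  ∀ A ∈ K.atoms, HasType S (List.replicate K.arity .iota) A .o ∧
    A.IsRigid ∧ A.InU1 ∧ A.BetaNormal

/-- `K'` is a term-form ground instance of `K`: the universally quantified variables are
replaced by closed β-normal terms of type `iota` that contain neither `∀` nor `⊃`. -/
def IsTermInstance (S : Sig) (K K' : HFormula) : Prop :=
  ∃ σ : ℕ → Tm,
    (∀ i < K.arity, HasType S [] (σ i) .iota ∧ (σ i).InU1 ∧ (σ i).BetaNormal) ∧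
    K' = { arity := 0, body := K.body.map (Tm.subst σ), head := Tm.subst σ K.head }

end HFormula

/-- A logic program over `S`: a finite set of H-formulae over `S`. -/
def IsProgram (S : Sig) (P : Set HFormula) : Prop :=
  P.Finite ∧ ∀ K ∈ P, K.WellFormed S

/-! ### Trees and coinductive Herbrand models -/

/-- Node labels: constants, variables, and the symbol `◇` used in snapshots. -/
inductive Label : Type
  | con : ℕ → Label
  | var : ℕ → Label
  | hole : Label

/-- Labelled trees as partial maps from finite lists of natural numbers (addresses, read from the
root) to labels. -/
abbrev Tree : Type := List ℕ → Option Label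

/-- `t` is a closed tree over `S`, finite or infinite, whose root is a constant with target type
`ρ` and whose other nodes are function symbols. The clause `child` says that a node labelled by a
constant of arity `k` has precisely the children `0, …, k - 1`, so that the domain of `t` is a
finitely branching tree language. -/
structure IsClosedTree (S : Sig) (ρ : Ty) (t : Tree) : Prop where
  root : ∃ c k, t [] = some (.con c) ∧ S c = some (Ty.arrows k ρ)
  node : ∀ w i l, t (w ++ [i]) = some l → ∃ c k, l = .con c ∧ S c = some (Ty.arrows k .iota)
  child : ∀ w i, (t (w ++ [i])).isSome ↔
    ∃ c k σ, t w = some (.con c) ∧ (σ = Ty.iota ∨ σ = Ty.o) ∧ S c = some (Ty.arrows k σ) ∧ i < k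

/-- The coinductive Herbrand universe: all closed tree-terms, finite or infinite. -/
def herbrandUniverse (S : Sig) : Set Tree := {t | IsClosedTree S .iota t}

/-- The coinductive Herbrand base: all closed tree-atoms, finite or infinite. -/
def herbrandBase (S : Sig) : Set Tree := {t | IsClosedTree S .o t}

/-- Simultaneous substitution of trees for the variables of a tree. -/
def treeSubst (θ : ℕ → Tree) : Tree → Tree
  | t, [] => match t [] with
    | some (.var x) => θ x []
    | r => r
  | t, i :: w => match t [] with
    | some (.var x) => θ x (i :: w)
    | _ => treeSubst θ (fun v => t (i :: v)) w

/-- The tree of the snapshot of a term: the maximal part of the term that is built from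
constants and variables, with `◇` in place of the other subterms. -/
def snapshot : Tm → Tree
  | M, [] => match M.head, M.args with
    | .cst c, _ => some (.con c)
    | .var x, [] => some (.var x)
    | _, _ => some .hole
  | M, i :: w => match M.head with
    | .cst _ => match M.args[i]? with
      | some N => snapshot N w
      | none => none
    | _ => none

/-- `t` is the (finite or infinite) tree `M^T` of the term or atom `M`: it is free of `◇`, and it
is a limit, in the tree metric, of snapshots of terms that are `fix`β-equivalent to `M`. Two trees
are at distance less than `2 ^ (-n)` just if their truncations at depth `n` coincide. -/
def IsTreeOf (M : Tm) (t : Tree) : Prop :=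
  (∀ w, t w ≠ some .hole) ∧
  ∀ n : ℕ, ∃ M', Tm.FixBetaEq M M' ∧ ∀ w : List ℕ, w.length < n → snapshot M' w = t w

/-- The immediate consequence operator: `B` is in `𝒯 I` if `B` is the head of a tree-form ground
instance, with body included in `I`, of an H-formula in `P`. -/
def consequence (S : Sig) (P : Set HFormula) : Set Tree →o Set Tree where
  toFun I := {B | B ∈ herbrandBase S ∧ ∃ K ∈ P, ∃ θ : ℕ → Tree,
    (∀ i < K.arity, θ i ∈ herbrandUniverse S) ∧
    (∃ t, IsTreeOf K.head t ∧ treeSubst θ t = B) ∧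
    ∀ A ∈ K.body, ∃ t, IsTreeOf A t ∧ treeSubst θ t ∈ I}
  monotone' := by
    rintro I J hIJ B ⟨hB, K, hK, θ, hθ, hh, hb⟩
    refine ⟨hB, K, hK, θ, hθ, hh, fun A hA => ?_⟩
    obtain ⟨t, ht, htI⟩ := hb A hA
    exact ⟨t, ht, hIJ htI⟩

/-- The coinductive model: the greatest fixed point of the immediate consequence operator. -/
def coinductiveModel (S : Sig) (P : Set HFormula) : Set Tree :=
  OrderHom.gfp (consequence S P)

end CUP

/-!
A program that has more rules has a larger coinductive model, so only one inclusion is at stake.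

Let `X` be the coinductive model of `P ∪ {H}`, in which all tree-form instances of `H` count as
rules. It is closed under the rules of `P` and under those of `H`. A guarded proof of `H` replaces
the variables of `H` by eigenconstants, assumes the body of `H` and `H` itself, and then has to
select a clause of `P` for the guarded head of `H`. Everything above that step is an ordinary proof
from `P`, `H` and the body. If the eigenconstants take arbitrary closed trees as values for which
the body lies in `X`, then `P`, `H` and the body are true in `X`. So the premises of the selected
clause have values in `X`, and the head of `H` has its value in `𝒯_P X`
(`consequence_singleton_subset`, from the soundness theorem `Proof.sound`). Hence `X ⊆ 𝒯_P X`, and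
`X` is contained in the greatest fixed point of `𝒯_P`
(`coinductiveModel_union_singleton_subset`). Finally, a term-form instance of `H` with guarded
atoms yields no more than the tree-form instances of `H` do
(`consequence_singleton_subset_of_isTermInstance`), so that the model of `P ∪ {H₁, …, Hₙ}` is
contained in `X`.

The argument needs that the tree of a term is determined by its `fix`β-equivalence class. This
rests on the Church–Rosser property of `fix`β-reduction, proved by parallel reduction and complete
developments (`FixBetaEq.join`, `treeOf_congr`). Guarded terms can be unfolded to any depth
(`GuardedFull.unfold`), so their trees exist and unfolding commutes with substitution
(`treeSubstCon_treeOf_subst`). A term that is substituted for a variable need not have a tree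
itself, if the variable disappears in the unfolding; `exists_treeSubst_eq` deals with such terms.
-/

namespace CUP

namespace Tm

/-! ### Substitution -/

/-- The substitution that replaces the variable `0` by `N` and lowers the others. -/
def single (N : Tm) : ℕ → Tm
  | 0 => N
  | i + 1 => var i

theorem inst_eq_subst (M N : Tm) : inst M N = subst (single N) M := by
  unfold inst
  congr 1

theorem rename_rename (ρ ρ' : ℕ → ℕ) (M : Tm) :
    rename ρ' (rename ρ M) = rename (fun i => ρ' (ρ i)) M := by
  have upRen_upRen : ∀ ρ ρ' : ℕ → ℕ,
      (fun i => upRen ρ' (upRen ρ i)) = upRen (fun i => ρ' (ρ i)) := by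
    intro ρ ρ'
    funext i
    cases i <;> rfl
  induction M generalizing ρ ρ' <;> simp_all [rename]

theorem subst_rename (ρ : ℕ → ℕ) (σ : ℕ → Tm) (M : Tm) :
    subst σ (rename ρ M) = subst (fun i => σ (ρ i)) M := by
  have up_upRen : ∀ (ρ : ℕ → ℕ) (σ : ℕ → Tm),
      (fun i => up σ (upRen ρ i)) = up (fun i => σ (ρ i)) := by
    intro ρ σ
    funext i
    cases i <;> rfl
  induction M generalizing ρ σ <;> simp_all [rename, subst]

theorem rename_subst (σ : ℕ → Tm) (ρ : ℕ → ℕ) (M : Tm) :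
    rename ρ (subst σ M) = subst (fun i => rename ρ (σ i)) M := by
  have rename_up : ∀ (σ : ℕ → Tm) (ρ : ℕ → ℕ),
      (fun i => rename (upRen ρ) (up σ i)) = up (fun i => rename ρ (σ i)) := by
    intro σ ρ
    funext i
    cases i with
    | zero => rfl
    | succ i => simp [up, rename_rename, upRen]
  induction M generalizing σ ρ <;> simp_all [rename, subst]

theorem subst_up_up (σ τ : ℕ → Tm) (i : ℕ) :
    subst (up τ) (up σ i) = up (fun i => subst τ (σ i)) i := by
  cases i with
  | zero => rfl
  | succ i => simp [up, subst_rename, rename_subst]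

theorem subst_subst (σ τ : ℕ → Tm) (M : Tm) :
    subst τ (subst σ M) = subst (fun i => subst τ (σ i)) M := by
  induction M generalizing σ τ <;> simp_all [subst, subst_up_up]

theorem up_var : up var = var := by
  funext i
  cases i <;> rfl

theorem subst_var (M : Tm) : subst var M = M := by
  induction M <;> simp_all [subst, up_var]

theorem rename_eq_subst (ρ : ℕ → ℕ) (M : Tm) :
    rename ρ M = subst (fun i => var (ρ i)) M := by
  rw [← subst_rename, subst_var]

theorem subst_inst (σ : ℕ → Tm) (M N : Tm) :
    subst σ (inst M N) = inst (subst (up σ) M) (subst σ N) := by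
  simp only [inst_eq_subst, subst_subst]
  congr 1
  funext i
  cases i with
  | zero => rfl
  | succ i => simp [up, single, subst, subst_rename, subst_var]

theorem rename_inst (ρ : ℕ → ℕ) (M N : Tm) :
    rename ρ (inst M N) = inst (rename (upRen ρ) M) (rename ρ N) := by
  simp only [rename_eq_subst, subst_inst]
  congr 2
  funext i
  cases i <;> rfl

theorem iterate_up_lt (σ : ℕ → Tm) {m i : ℕ} (hi : i < m) : up^[m] σ i = var i := by
  induction m generalizing i with
  | zero => omega
  | succ m ih =>
    rw [Function.iterate_succ_apply']
    cases i with
    | zero => rfl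
    | succ i => simp [up, ih (Nat.lt_of_succ_lt_succ hi), rename]

theorem iterate_up_add (σ : ℕ → Tm) (m i : ℕ) :
    up^[m] σ (m + i) = rename (fun j => m + j) (σ i) := by
  induction m with
  | zero =>
    simp only [Function.iterate_zero, id, Nat.zero_add, rename_eq_subst]
    exact (subst_var _).symm
  | succ m ih =>
    rw [Function.iterate_succ_apply', Nat.add_right_comm]
    simp [up, ih, rename_rename, Nat.add_right_comm]

theorem subst_iterate_up (σ τ : ℕ → Tm) (m i : ℕ) :
    subst (up^[m] τ) (up^[m] σ i) = up^[m] (fun i => subst τ (σ i)) i := by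
  induction m generalizing σ τ with
  | zero => rfl
  | succ m ih => simp only [Function.iterate_succ_apply, ih, subst_up_up]

theorem iterate_up_var (m : ℕ) : up^[m] var = var := by
  induction m with
  | zero => rfl
  | succ m ih => rw [Function.iterate_succ_apply', ih, up_var]

theorem subst_apps (σ : ℕ → Tm) (M : Tm) (Ms : List Tm) :
    subst σ (apps M Ms) = apps (subst σ M) (Ms.map (subst σ)) := by
  induction Ms generalizing M with
  | nil => rfl
  | cons N Ms ih => exact ih (app M N)

theorem subst_lams (σ : ℕ → Tm) (m : ℕ) (M : Tm) :
    subst σ (lams m M) = lams m (subst (up^[m] σ) M) := by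
  induction m generalizing σ with
  | zero => rfl
  | succ m ih => simp [lams, subst, ih]

/-- Typable terms have their free variables in the context. -/
theorem subst_congr_of_hasType {S : Sig} {Γ : List Ty} {M : Tm} {τ : Ty} (h : HasType S Γ M τ)
    {σ σ' : ℕ → Tm} (hσ : ∀ i < Γ.length, σ i = σ' i) : subst σ M = subst σ' M := by
  have lift : ∀ {Γ : List Ty} {τ : Ty} {σ σ' : ℕ → Tm}, (∀ i < Γ.length, σ i = σ' i) →
      ∀ i < (τ :: Γ).length, up σ i = up σ' i := by
    intro Γ τ σ σ' hσ i hi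
    cases i with
    | zero => rfl
    | succ i => simp [up, hσ i (by simpa using hi)]
  induction h generalizing σ σ' with
  | var h =>
    obtain ⟨h, -⟩ := List.getElem?_eq_some_iff.1 h
    exact hσ _ h
  | con h => rfl
  | log => rfl
  | app _ _ ih₁ ih₂ => simp [subst, ih₁ hσ, ih₂ hσ]
  | abs _ ih => simp [subst, ih (lift hσ)]
  | fp _ ih => simp [subst, ih (lift hσ)]

/-- Closed terms, as those that are fixed by all substitutions. -/
def Closed (M : Tm) : Prop := ∀ σ, subst σ M = M

theorem Closed.of_hasType {S : Sig} {M : Tm} {τ : Ty} (h : HasType S [] M τ) : M.Closed := by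
  intro σ
  rw [subst_congr_of_hasType h (σ' := var) (by simp), subst_var]

/-! ### Spines -/

theorem apps_append (M : Tm) (Ms Ns : List Tm) : apps M (Ms ++ Ns) = apps (apps M Ms) Ns :=
  List.foldl_append

theorem apps_head_args (M : Tm) : apps M.head M.args = M := by
  induction M with
  | app M N ih _ => simp only [head, args, apps_append, ih]; rfl
  | _ => rfl

theorem head_apps (M : Tm) (Ms : List Tm) : (apps M Ms).head = M.head := by
  induction Ms generalizing M with
  | nil => rfl
  | cons N Ms ih => exact ih (app M N)

theorem args_apps (M : Tm) (Ms : List Tm) : (apps M Ms).args = M.args ++ Ms := by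
  induction Ms generalizing M with
  | nil => simp [apps]
  | cons N Ms ih => exact (ih (app M N)).trans (by simp [args])

theorem apps_cst_inj {c c' : ℕ} {Ms Ms' : List Tm} (h : apps (cst c) Ms = apps (cst c') Ms') :
    c = c' ∧ Ms = Ms' := by
  have h₁ := congrArg head h
  have h₂ := congrArg args h
  simpa [head_apps, args_apps, head, args] using And.intro h₁ h₂

/-! ### The Church–Rosser property of `fix`β-reduction -/

/-- Parallel `fix`β-reduction. -/
inductive Par : Tm → Tm → Prop
  | var (i : ℕ) : Par (var i) (var i)
  | cst (c : ℕ) : Par (cst c) (cst c)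
  | log (l : LCon) : Par (log l) (log l)
  | app {M M' N N' : Tm} : Par M M' → Par N N' → Par (app M N) (app M' N')
  | lam {M M' : Tm} : Par M M' → Par (lam M) (lam M')
  | fix {M M' : Tm} : Par M M' → Par (fix M) (fix M')
  | beta {M M' N N' : Tm} : Par M M' → Par N N' → Par (app (lam M) N) (inst M' N')
  | unfold {M M' : Tm} : Par M M' → Par (fix M) (inst M' (fix M'))

theorem Par.refl (M : Tm) : Par M M := by
  induction M with
  | var i => exact .var i
  | cst c => exact .cst c
  | log l => exact .log l
  | app M N ihM ihN => exact .app ihM ihN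
  | lam M ih => exact .lam ih
  | fix M ih => exact .fix ih

theorem Par.rename {M M' : Tm} (h : Par M M') (ρ : ℕ → ℕ) :
    Par (Tm.rename ρ M) (Tm.rename ρ M') := by
  induction h generalizing ρ with
  | var i => exact .refl _
  | cst c => exact .refl _
  | log l => exact .refl _
  | app _ _ ihM ihN => exact .app (ihM ρ) (ihN ρ)
  | lam _ ih => exact .lam (ih _)
  | fix _ ih => exact .fix (ih _)
  | beta _ _ ihM ihN => rw [rename_inst]; exact .beta (ihM _) (ihN ρ)
  | unfold _ ih => rw [rename_inst]; exact .unfold (ih _)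

theorem Par.subst {M M' : Tm} (h : Par M M') {σ σ' : ℕ → Tm} (hσ : ∀ i, Par (σ i) (σ' i)) :
    Par (Tm.subst σ M) (Tm.subst σ' M') := by
  have lift : ∀ {σ σ' : ℕ → Tm}, (∀ i, Par (σ i) (σ' i)) → ∀ i, Par (up σ i) (up σ' i) := by
    intro σ σ' hσ i
    cases i with
    | zero => exact .var 0
    | succ i => exact (hσ i).rename _
  induction h generalizing σ σ' with
  | var i => exact hσ i
  | cst c => exact .cst c
  | log l => exact .log l
  | app _ _ ihM ihN => exact .app (ihM hσ) (ihN hσ)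
  | lam _ ih => exact .lam (ih (lift hσ))
  | fix _ ih => exact .fix (ih (lift hσ))
  | beta _ _ ihM ihN => rw [subst_inst]; exact .beta (ihM (lift hσ)) (ihN hσ)
  | unfold _ ih => rw [subst_inst]; exact .unfold (ih (lift hσ))

theorem Par.inst {M M' N N' : Tm} (hM : Par M M') (hN : Par N N') :
    Par (Tm.inst M N) (Tm.inst M' N') := by
  rw [inst_eq_subst, inst_eq_subst]
  refine hM.subst fun i => ?_
  cases i with
  | zero => exact hN
  | succ i => exact .var i

/-- The complete development of a term: all redexes present in it are contracted at once. -/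
def develop : Tm → Tm
  | app (lam M) N => inst (develop M) (develop N)
  | app M N => app (develop M) (develop N)
  | lam M => lam (develop M)
  | fix M => inst (develop M) (fix (develop M))
  | M => M

/-- Every parallel reduct of `M` reduces in one parallel step to the complete development of `M`;
this gives the diamond property. -/
theorem Par.triangle {M N : Tm} (h : Par M N) : Par N (develop M) := by
  induction h with
  | var i => exact .var i
  | cst c => exact .cst c
  | log l => exact .log l
  | @app M M' N N' hM _ ihM ihN =>
    cases hM with
    | lam hM =>
      simp only [develop] at ihM ⊢
      cases ihM with
      | lam ihM => exact .beta ihM ihN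
    | _ => exact .app ihM ihN
  | lam _ ih => exact .lam ih
  | fix _ ih => exact .unfold ih
  | beta _ _ ihM ihN => exact ihM.inst ihN
  | unfold _ ih => exact ih.inst (.fix ih)

theorem FixBetaEq.refl (M : Tm) : FixBetaEq M M := Relation.EqvGen.refl M

theorem FixBetaEq.symm {M N : Tm} (h : FixBetaEq M N) : FixBetaEq N M := Relation.EqvGen.symm _ _ h

theorem FixBetaEq.trans {L M N : Tm} (h : FixBetaEq L M) (h' : FixBetaEq M N) : FixBetaEq L N :=
  Relation.EqvGen.trans _ _ _ h h'

theorem FixBetaEq.of_beta {M N : Tm} (h : BetaStep M N) : FixBetaEq M N := .rel _ _ (.inl h)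

theorem FixBetaEq.of_fix {M N : Tm} (h : FixStep M N) : FixBetaEq M N := .rel _ _ (.inr h)

theorem FixBetaEq.forall₂_trans {Ls Ms Ns : List Tm} (h : List.Forall₂ FixBetaEq Ls Ms)
    (h' : List.Forall₂ FixBetaEq Ms Ns) : List.Forall₂ FixBetaEq Ls Ns := by
  induction h generalizing Ns with
  | nil => exact h'
  | cons h _ ih => cases h' with
    | cons h' hs => exact .cons (h.trans h') (ih hs)

/-- A map on terms that preserves the steps preserves `fix`β-equivalence. -/
theorem FixBetaEq.map {f : Tm → Tm} (hβ : ∀ {M N}, BetaStep M N → BetaStep (f M) (f N))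
    (hfix : ∀ {M N}, FixStep M N → FixStep (f M) (f N)) {M N : Tm} (h : FixBetaEq M N) :
    FixBetaEq (f M) (f N) := by
  induction h with
  | rel _ _ h => exact .rel _ _ (h.imp hβ hfix)
  | refl => exact .refl _
  | symm _ _ _ ih => exact ih.symm
  | trans _ _ _ _ _ ih₁ ih₂ => exact ih₁.trans ih₂

theorem FixBetaEq.app {M M' N N' : Tm} (hM : FixBetaEq M M') (hN : FixBetaEq N N') :
    FixBetaEq (app M N) (app M' N') :=
  (hM.map (f := fun M => Tm.app M N) (.appL N) (.appL N)).trans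
    (hN.map (f := Tm.app M') (.appR M') (.appR M'))

theorem FixBetaEq.apps {M M' : Tm} {Ms Ms' : List Tm} (hM : FixBetaEq M M')
    (hMs : List.Forall₂ FixBetaEq Ms Ms') : FixBetaEq (apps M Ms) (apps M' Ms') := by
  induction hMs generalizing M M' with
  | nil => exact hM
  | cons h _ ih => exact ih (hM.app h)

theorem Par.fixBetaEq {M N : Tm} (h : Par M N) : FixBetaEq M N := by
  induction h with
  | var i => exact .refl _
  | cst c => exact .refl _
  | log l => exact .refl _
  | app _ _ ihM ihN => exact ihM.app ihN
  | lam _ ih => exact ih.map .lam .lam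
  | fix _ ih => exact ih.map .fix .fix
  | beta _ _ ihM ihN => exact ((ihM.map .lam .lam).app ihN).trans (.of_beta (.beta _ _))
  | unfold _ ih => exact (ih.map .fix .fix).trans (.of_fix (.unfold _))

theorem BetaStep.par {M N : Tm} (h : BetaStep M N) : Par M N := by
  induction h with
  | beta M N => exact .beta (.refl M) (.refl N)
  | appL L _ ih => exact .app ih (.refl L)
  | appR L _ ih => exact .app (.refl L) ih
  | lam _ ih => exact .lam ih
  | fix _ ih => exact .fix ih

theorem FixStep.par {M N : Tm} (h : FixStep M N) : Par M N := by
  induction h with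
  | unfold M => exact .unfold (.refl M)
  | appL L _ ih => exact .app ih (.refl L)
  | appR L _ ih => exact .app (.refl L) ih
  | lam _ ih => exact .lam ih
  | fix _ ih => exact .fix ih

theorem FixBetaEq.join {M N : Tm} (h : FixBetaEq M N) :
    Relation.Join (Relation.ReflTransGen Par) M N := by
  have equiv : Equivalence (Relation.Join (Relation.ReflTransGen Par)) :=
    Relation.equivalence_join_reflTransGen fun a b c hab hac =>
      ⟨develop a, .single hab.triangle, .single hac.triangle⟩
  induction h with
  | rel _ N h => exact ⟨N, .single (h.elim BetaStep.par FixStep.par), .refl⟩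
  | refl M => exact equiv.refl M
  | symm _ _ _ ih => exact equiv.symm ih
  | trans _ _ _ _ _ ih₁ ih₂ => exact equiv.trans ih₁ ih₂

theorem Par.apps_cst {c : ℕ} {Ms : List Tm} {N : Tm} (h : Par (apps (Tm.cst c) Ms) N) :
    ∃ Ns, N = apps (Tm.cst c) Ns ∧ List.Forall₂ FixBetaEq Ms Ns := by
  induction Ms using List.reverseRecOn generalizing N with
  | nil => cases h; exact ⟨[], rfl, .nil⟩
  | append_singleton Ms M ih =>
    rw [apps_append] at h
    generalize hL : apps (Tm.cst c) Ms = L at h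
    cases h with
    | app hL' hM =>
      subst hL
      obtain ⟨Ns, rfl, hNs⟩ := ih hL'
      exact ⟨Ns ++ [_], by rw [apps_append]; rfl,
        List.rel_append hNs (.cons hM.fixBetaEq .nil)⟩
    | beta => simpa [head_apps, head] using congrArg head hL

theorem apps_cst_of_reflTransGen_par {c : ℕ} {Ms : List Tm} {N : Tm}
    (h : Relation.ReflTransGen Par (apps (cst c) Ms) N) :
    ∃ Ns, N = apps (cst c) Ns ∧ List.Forall₂ FixBetaEq Ms Ns := by
  induction h with
  | refl => exact ⟨Ms, rfl, List.forall₂_same.2 fun M _ => .refl M⟩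
  | tail _ h ih =>
    obtain ⟨Ns, rfl, hNs⟩ := ih
    obtain ⟨Ns', rfl, hNs'⟩ := h.apps_cst
    exact ⟨Ns', rfl, FixBetaEq.forall₂_trans hNs hNs'⟩

theorem eq_var_of_reflTransGen_par {i : ℕ} {N : Tm} (h : Relation.ReflTransGen Par (var i) N) :
    N = var i := by
  induction h with
  | refl => rfl
  | tail _ h ih => subst ih; cases h; rfl

theorem FixBetaEq.apps_cst {c c' : ℕ} {Ms Ms' : List Tm}
    (h : FixBetaEq (Tm.apps (cst c) Ms) (Tm.apps (cst c') Ms')) :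
    c = c' ∧ List.Forall₂ FixBetaEq Ms Ms' := by
  obtain ⟨L, h₁, h₂⟩ := h.join
  obtain ⟨Ns, rfl, hNs⟩ := apps_cst_of_reflTransGen_par h₁
  obtain ⟨Ns', h', hNs'⟩ := apps_cst_of_reflTransGen_par h₂
  obtain ⟨rfl, rfl⟩ := apps_cst_inj h'
  exact ⟨rfl, FixBetaEq.forall₂_trans hNs (hNs'.flip.imp fun _ _ h => h.symm)⟩

theorem FixBetaEq.var_inj {i j : ℕ} (h : FixBetaEq (var i) (var j)) : i = j := by
  obtain ⟨L, h₁, h₂⟩ := h.join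
  have := (eq_var_of_reflTransGen_par h₁).symm.trans (eq_var_of_reflTransGen_par h₂)
  exact Tm.var.inj this

theorem not_fixBetaEq_var_apps_cst {i c : ℕ} {Ms : List Tm} :
    ¬ FixBetaEq (var i) (apps (cst c) Ms) := by
  intro h
  obtain ⟨L, h₁, h₂⟩ := h.join
  obtain ⟨Ns, h', -⟩ := apps_cst_of_reflTransGen_par h₂
  rw [eq_var_of_reflTransGen_par h₁] at h'
  simpa [head_apps, head] using congrArg head h'

theorem BetaStep.subst {M N : Tm} (h : BetaStep M N) (σ : ℕ → Tm) :
    BetaStep (Tm.subst σ M) (Tm.subst σ N) := by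
  induction h generalizing σ with
  | beta M N => rw [subst_inst]; exact .beta _ _
  | appL L _ ih => exact .appL _ (ih σ)
  | appR L _ ih => exact .appR _ (ih σ)
  | lam _ ih => exact .lam (ih _)
  | fix _ ih => exact .fix (ih _)

theorem FixStep.subst {M N : Tm} (h : FixStep M N) (σ : ℕ → Tm) :
    FixStep (Tm.subst σ M) (Tm.subst σ N) := by
  induction h generalizing σ with
  | unfold M => rw [subst_inst]; exact .unfold _
  | appL L _ ih => exact .appL _ (ih σ)
  | appR L _ ih => exact .appR _ (ih σ)
  | lam _ ih => exact .lam (ih _)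
  | fix _ ih => exact .fix (ih _)

theorem FixBetaEq.subst {M N : Tm} (h : FixBetaEq M N) (σ : ℕ → Tm) :
    FixBetaEq (Tm.subst σ M) (Tm.subst σ N) :=
  h.map (·.subst σ) (·.subst σ)

end Tm

open Tm

/-! ### The tree of a term -/

open Classical in
/-- The label at an address of the tree to which a term unfolds. At the root it is the constant or
variable that heads a term `fix`β-equivalent to the given one; below the root the search continues
in the arguments of such a term. There is no label if no such term exists. By the Church–Rosser
property the choices do not matter. -/
noncomputable def treeAt : List ℕ → Tm → Option Label
  | [], M =>
    if h : ∃ c Ms, FixBetaEq M (apps (cst c) Ms) then some (.con h.choose)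
    else if h : ∃ x, FixBetaEq M (var x) then some (.var h.choose)
    else none
  | i :: w, M =>
    if h : ∃ Ms c, FixBetaEq M (apps (cst c) Ms) then h.choose[i]?.bind (treeAt w) else none

/-- The tree to which a term unfolds under `fix`β-equivalence. -/
noncomputable def treeOf (M : Tm) : Tree := fun w => treeAt w M

theorem treeOf_congr {M N : Tm} (h : FixBetaEq M N) : treeOf M = treeOf N := by
  have key : FixBetaEq M = FixBetaEq N := funext fun L => propext ⟨h.symm.trans, h.trans⟩
  funext w
  cases w <;> (unfold treeOf treeAt; rw [key])

theorem treeOf_var_nil (x : ℕ) : treeOf (var x) [] = some (.var x) := by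
  have h₁ : ¬ ∃ c Ms, FixBetaEq (var x) (apps (cst c) Ms) :=
    fun ⟨_, _, h⟩ => not_fixBetaEq_var_apps_cst h
  have h₂ : ∃ y, FixBetaEq (var x) (var y) := ⟨x, .refl _⟩
  simp only [treeOf, treeAt, h₁, h₂, dite_false, dite_true]
  rw [← h₂.choose_spec.var_inj]

theorem treeOf_var_cons (x i : ℕ) (w : List ℕ) : treeOf (var x) (i :: w) = none := by
  have h : ¬ ∃ Ms c, FixBetaEq (var x) (apps (cst c) Ms) :=
    fun ⟨_, _, h⟩ => not_fixBetaEq_var_apps_cst h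
  simp only [treeOf, treeAt, h, dite_false]

theorem treeOf_apps_nil (c : ℕ) (Ms : List Tm) :
    treeOf (apps (cst c) Ms) [] = some (.con c) := by
  have h : ∃ c' Ms', FixBetaEq (apps (cst c) Ms) (apps (cst c') Ms') := ⟨c, Ms, .refl _⟩
  simp only [treeOf, treeAt, h, dite_true]
  obtain ⟨Ms', h'⟩ := h.choose_spec
  rw [← h'.apps_cst.1]

theorem treeOf_apps_cons (c : ℕ) (Ms : List Tm) (i : ℕ) (w : List ℕ) :
    treeOf (apps (cst c) Ms) (i :: w) = Ms[i]?.bind fun M => treeOf M w := by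
  have h : ∃ Ms' c', FixBetaEq (apps (cst c) Ms) (apps (cst c') Ms') := ⟨Ms, c, .refl _⟩
  simp only [treeOf, treeAt, h, dite_true]
  obtain ⟨c', h'⟩ := h.choose_spec
  have aux : ∀ {Ms Ns : List Tm}, List.Forall₂ FixBetaEq Ms Ns → ∀ i : ℕ,
      Ns[i]?.bind (treeAt w) = Ms[i]?.bind (treeAt w) := by
    intro Ms Ns hs
    induction hs with
    | nil => intro i; rfl
    | cons h _ ih =>
      intro i
      cases i with
      | zero => exact congrFun (treeOf_congr h.symm) w
      | succ i => simpa using ih i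
  exact aux h'.apps_cst.2 i

theorem treeOf_apps_subtree (c : ℕ) {Ms : List Tm} {i : ℕ} (hi : i < Ms.length) :
    (fun w => treeOf (apps (cst c) Ms) (i :: w)) = treeOf Ms[i] := by
  funext w
  simp [treeOf_apps_cons, hi]

theorem treeOf_apps_cons_of_le (c : ℕ) {Ms : List Tm} {i : ℕ} (hi : Ms.length ≤ i) (w : List ℕ) :
    treeOf (apps (cst c) Ms) (i :: w) = none := by
  simp [treeOf_apps_cons, hi]

theorem treeOf_ne_hole (M : Tm) (w : List ℕ) : treeOf M w ≠ some .hole := by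
  induction w generalizing M with
  | nil => simp only [treeOf, treeAt]; split_ifs <;> simp
  | cons i w ih =>
    simp only [treeOf, treeAt]
    split_ifs with h
    · rcases h.choose[i]? with _ | N
      · simp
      · exact ih N
    · simp

theorem head_ne_app (M A B : Tm) : M.head ≠ app A B := by
  induction M with
  | app M N ih _ => exact ih
  | _ => simp [head]

/-- Where a snapshot of a term has no hole, it agrees with the tree of the term. -/
theorem snapshot_eq_treeOf {M : Tm} {w : List ℕ}
    (h : ∀ v : List ℕ, v.length ≤ w.length → snapshot M v ≠ some .hole) :
    snapshot M w = treeOf M w := by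
  induction w generalizing M with
  | nil =>
    have h₀ := h [] le_rfl
    rw [← apps_head_args M]
    rw [← apps_head_args M] at h₀
    simp only [snapshot, head_apps, args_apps] at h₀ ⊢
    cases hM : M.head with
    | cst c => simp [treeOf_apps_nil, head]
    | var x =>
      cases hN : M.args with
      | nil => simpa [apps, head, args] using (treeOf_var_nil x).symm
      | cons N Ns => simp [hM, hN, head, args] at h₀
    | app M' N' => exact absurd hM (head_ne_app M M' N')
    | _ => simp [hM, head] at h₀
  | cons i w ih =>
    have h₀ := h [] (by simp)
    cases hM : M.head with
    | cst c =>
      have hM' : M = apps (cst c) M.args := by rw [← hM, apps_head_args]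
      rw [hM', treeOf_apps_cons, ← hM']
      simp only [snapshot, hM]
      cases hN : M.args[i]? with
      | none => rfl
      | some N =>
        refine ih fun v hv => ?_
        have := h (i :: v) (by simpa using hv)
        simpa only [snapshot, hM, hN] using this
    | var x =>
      cases hN : M.args with
      | nil =>
        have hM' : M = var x := by rw [← apps_head_args M, hM, hN]; rfl
        rw [hM', treeOf_var_cons]
        rfl
      | cons N Ns => simp [snapshot, hM, hN] at h₀
    | _ => simp [snapshot, hM] at h₀

/-- A term has at most one tree. -/
theorem IsTreeOf.eq_treeOf {M : Tm} {t : Tree} (h : IsTreeOf M t) : t = treeOf M := by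
  funext w
  obtain ⟨M', hM, h'⟩ := h.2 (w.length + 1)
  rw [treeOf_congr hM, ← h' w (by omega)]
  exact snapshot_eq_treeOf fun v hv => by rw [h' v (by omega)]; exact h.1 v

/-! ### Guarded terms unfold to infinite depth -/

theorem fv_apps (M : Tm) (Ms : List Tm) (i : ℕ) :
    i ∈ (apps M Ms).fv ↔ i ∈ M.fv ∨ ∃ N ∈ Ms, i ∈ N.fv := by
  induction Ms generalizing M with
  | nil => simp [apps]
  | cons N Ms ih => exact (ih (app M N)).trans (by simp [fv, or_assoc])

theorem FOTerm.subst {S : Sig} {M : Tm} (h : FOTerm S M) {σ : ℕ → Tm}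
    (hσ : ∀ i ∈ M.fv, FOTerm S (σ i)) : FOTerm S (Tm.subst σ M) := by
  induction h with
  | var i => exact hσ i rfl
  | fn f Ms hf _ ih =>
    rw [subst_apps]
    refine .fn f _ (by simpa using hf) fun N hN => ?_
    obtain ⟨M, hM, rfl⟩ := List.mem_map.1 hN
    exact ih M hM fun i hi => hσ i ((fv_apps _ _ _).2 (.inr ⟨M, hM, hi⟩))

/-- Applying an iterated abstraction to as many terms performs a simultaneous substitution. -/
theorem exists_apps_lams_fixBetaEq (Ms : List Tm) : ∃ τ : ℕ → Tm,
    (∀ i < Ms.length, τ i ∈ Ms) ∧ (∀ i, τ (Ms.length + i) = var i) ∧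
    ∀ B, FixBetaEq (apps (lams Ms.length B) Ms) (Tm.subst τ B) := by
  induction Ms with
  | nil => exact ⟨var, by simp, by simp, fun B => by rw [subst_var]; exact .refl _⟩
  | cons N Ms ih =>
    obtain ⟨τ, hτ, hτ', h⟩ := ih
    refine ⟨fun i => Tm.subst τ (up^[Ms.length] (single N) i), fun i hi => ?_, fun i => ?_,
      fun B => ?_⟩
    · rcases Nat.lt_succ_iff_lt_or_eq.1 hi with hi | rfl
      · simp only [iterate_up_lt _ hi, Tm.subst]
        exact .tail _ (hτ i hi)
      · have := iterate_up_add (single N) Ms.length 0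
        simp only [Nat.add_zero] at this
        simp [this, single, subst_rename, hτ', subst_var]
    · have := iterate_up_add (single N) Ms.length (i + 1)
      rw [List.length_cons, show Ms.length + 1 + i = Ms.length + (i + 1) by omega]
      simp [this, single, rename, Tm.subst, hτ']
    · rw [← subst_subst]
      refine FixBetaEq.trans ?_ (h _)
      rw [← subst_lams, ← inst_eq_subst]
      exact (FixBetaEq.of_beta (.beta _ _)).apps (List.forall₂_same.2 fun M _ => .refl M)

/-- `M` is `fix`β-equivalent to a guarded full term (for `ρ = iota`) or to a guarded atom in
the normal form `h M₁ … Mₙ` (for `ρ = o`). -/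
inductive Regular (S : Sig) : Ty → Tm → Prop
  | term {M N : Tm} : FixBetaEq M N → GuardedFull S N → Regular S .iota M
  | atom {M : Tm} (h : ℕ) (Ms : List Tm) : FixBetaEq M (apps (cst h) Ms) →
      S h = some (Ty.arrows Ms.length .o) → (∀ N ∈ Ms, GuardedFull S N) → Regular S .o M

theorem Regular.congr {S : Sig} {ρ : Ty} {M N : Tm} (h : Regular S ρ M) (hMN : FixBetaEq N M) :
    Regular S ρ N := by
  cases h with
  | term h h' => exact .term (hMN.trans h) h'
  | atom c Ms h hc hMs => exact .atom c Ms (hMN.trans h) hc hMs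

theorem Regular.iota_or_o {S : Sig} {ρ : Ty} {M : Tm} (h : Regular S ρ M) :
    ρ = .iota ∨ ρ = .o := by
  cases h <;> simp

theorem GuardedAtom.regular {S : Sig} {A : Tm} (h : GuardedAtom S A) : Regular S .o A := by
  obtain ⟨-, c, Ms, hc, hMs, h⟩ := h
  exact .atom c Ms h hc hMs

/-- Unfolding a guarded full term exposes a variable or a function symbol applied to guarded full
terms. For a guarded fixed point term this is one unfolding of the fixed point, whose recursive
call is again a guarded fixed point term applied to first-order terms. -/
theorem GuardedFull.unfold {S : Sig} {M : Tm} (h : GuardedFull S M) :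
    (∃ x, M = var x) ∨ ∃ f Ms, FixBetaEq M (apps (cst f) Ms) ∧
      S f = some (Ty.arrows Ms.length .iota) ∧ ∀ N ∈ Ms, GuardedFull S N := by
  rcases h with h | ⟨F, Ms, hF, hMs, rfl⟩
  · cases h with
    | var x => exact .inl ⟨x, rfl⟩
    | fn f Ms hf hMs => exact .inr ⟨f, Ms, .refl _, hf, fun N hN => .inl (hMs N hN)⟩
  · right
    have hF' := hF
    obtain ⟨f, Ls, Ls', Ns, hNs, hf, hFO, hfv, hFB⟩ := hF
    obtain ⟨τ, hτ, hτ', h⟩ := exists_apps_lams_fixBetaEq Ms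
    set m := Ms.length with hm
    set B := apps (cst f) (Ls ++ [apps (var m) Ns] ++ Ls') with hB
    -- The arguments replace the variables `y`, and the fixed point itself replaces `x`.
    let τ' : ℕ → Tm := fun i => Tm.subst τ (up^[m] (single F) i)
    have hlt : ∀ i < m, τ' i ∈ Ms := fun i hi => by
      simp only [τ', iterate_up_lt _ hi, Tm.subst]
      exact hτ i hi
    have hm' : τ' m = F := by
      have := iterate_up_add (single F) m 0
      simp only [Nat.add_zero] at this
      simp [τ', this, single, subst_rename, hτ', subst_var]
    have hsubst : ∀ L ∈ Ls ++ Ls' ++ Ns, FOTerm S (Tm.subst τ' L) := fun L hL =>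
      FOTerm.subst (hFO L hL) fun i hi => hMs _ (hlt i ((hfv i).1 ⟨L, hL, hi⟩))
    have hunfold : FixBetaEq (apps F Ms) (Tm.subst τ' B) := by
      rw [← subst_subst]
      refine FixBetaEq.trans ?_ (h _)
      rw [← subst_lams, ← inst_eq_subst, hFB]
      exact (FixBetaEq.of_fix (.unfold _)).apps (List.forall₂_same.2 fun M _ => .refl M)
    rw [hB, subst_apps] at hunfold
    refine ⟨f, _, hunfold, ?_, ?_⟩
    · rw [hf]
      simp [Nat.add_right_comm, Nat.add_assoc]
    · intro N hN
      simp only [List.map_append, List.map_cons, List.map_nil, List.mem_append, List.mem_map,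
        List.mem_singleton] at hN
      rcases hN with (⟨L, hL, rfl⟩ | rfl) | ⟨L, hL, rfl⟩
      · exact .inl (hsubst L (by simp [hL]))
      · refine .inr ⟨F, Ns.map (Tm.subst τ'), by simpa [hNs] using hF', ?_, ?_⟩
        · intro N hN
          obtain ⟨L, hL, rfl⟩ := List.mem_map.1 hN
          exact hsubst L (by simp [hL])
        · rw [subst_apps, Tm.subst, hm']
      · exact .inl (hsubst L (by simp [hL]))

theorem Regular.unfold {S : Sig} {ρ : Ty} {M : Tm} (h : Regular S ρ M) :
    (ρ = .iota ∧ ∃ x, FixBetaEq M (var x)) ∨ ∃ f Ms, FixBetaEq M (apps (cst f) Ms) ∧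
      S f = some (Ty.arrows Ms.length ρ) ∧ ∀ N ∈ Ms, Regular S .iota N := by
  cases h with
  | term h h' =>
    rcases GuardedFull.unfold h' with ⟨x, rfl⟩ | ⟨f, Ms, h'', hf, hMs⟩
    · exact .inl ⟨rfl, x, h⟩
    · exact .inr ⟨f, Ms, h.trans h'', hf, fun N hN => .term (.refl _) (hMs N hN)⟩
  | atom c Ms h hc hMs =>
    exact .inr ⟨c, Ms, h, hc, fun N hN => .term (.refl _) (hMs N hN)⟩

/-- A guarded term has snapshots without holes to any depth, hence a tree. -/
theorem Regular.isTreeOf {S : Sig} {ρ : Ty} {M : Tm} (h : Regular S ρ M) :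
    IsTreeOf M (treeOf M) := by
  refine ⟨treeOf_ne_hole M, fun n => ?_⟩
  induction n generalizing ρ M with
  | zero => exact ⟨M, .refl M, by simp⟩
  | succ n ih =>
    rcases h.unfold with ⟨-, x, hM⟩ | ⟨f, Ms, hM, -, hMs⟩
    · refine ⟨var x, hM, fun w _ => ?_⟩
      rw [treeOf_congr hM]
      cases w with
      | nil => exact (treeOf_var_nil x).symm
      | cons i w => exact (treeOf_var_cons x i w).symm
    · have : ∃ Ns, List.Forall₂ (fun M N => FixBetaEq M N ∧
          ∀ w : List ℕ, w.length < n → snapshot N w = treeOf M w) Ms Ns := by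
        clear hM
        induction Ms with
        | nil => exact ⟨[], .nil⟩
        | cons M Ms ih' =>
          obtain ⟨Ns, hNs⟩ := ih' fun N hN => hMs N (.tail _ hN)
          obtain ⟨N, hN⟩ := ih (hMs M (.head _))
          exact ⟨N :: Ns, .cons hN hNs⟩
      obtain ⟨Ns, hNs⟩ := this
      refine ⟨apps (cst f) Ns, hM.trans ((FixBetaEq.refl _).apps (hNs.imp fun _ _ h => h.1)),
        fun w hw => ?_⟩
      rw [treeOf_congr hM]
      cases w with
      | nil => simp [snapshot, head_apps, head, treeOf_apps_nil]
      | cons i w =>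
        replace hw : w.length < n := by simpa using hw
        simp only [snapshot, head_apps, head, args_apps, args, List.nil_append, treeOf_apps_cons]
        clear hM hMs
        induction hNs generalizing i with
        | nil => rfl
        | cons h _ ih =>
          cases i with
          | zero => exact h.2 w hw
          | succ i => simpa using ih i

/-! ### Substituting trees for variables and for eigenconstants -/

theorem treeSubst_eq_of_var {θ : ℕ → Tree} {t : Tree} {x : ℕ} (h : t [] = some (.var x)) :
    treeSubst θ t = θ x := by
  funext w
  cases w <;> simp [treeSubst, h]

theorem treeSubst_nil_of_con {θ : ℕ → Tree} {t : Tree} {c : ℕ} (h : t [] = some (.con c)) :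
    treeSubst θ t [] = some (.con c) := by
  simp [treeSubst, h]

theorem treeSubst_cons_of_con {θ : ℕ → Tree} {t : Tree} {c : ℕ} (h : t [] = some (.con c))
    (i : ℕ) (w : List ℕ) : treeSubst θ t (i :: w) = treeSubst θ (fun v => t (i :: v)) w := by
  simp [treeSubst, h]

theorem treeSubst_none (θ : ℕ → Tree) (w : List ℕ) : treeSubst θ (fun _ => none) w = none := by
  induction w with
  | nil => rfl
  | cons i w ih => exact ih

theorem treeSubst_congr {θ θ' : ℕ → Tree} {t : Tree}
    (h : ∀ w x, t w = some (.var x) → θ x = θ' x) : treeSubst θ t = treeSubst θ' t := by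
  funext w
  induction w generalizing t with
  | nil =>
    simp only [treeSubst]
    split
    · next x hx => rw [h _ _ hx]
    · rfl
  | cons i w ih =>
    simp only [treeSubst]
    split
    · next x hx => rw [h _ _ hx]
    · exact ih fun v x hx => h (i :: v) x hx

/-- The tree assigned by `κ` to the constant that labels a node, if there is one. -/
def eigenTree (κ : ℕ → Option Tree) : Option Label → Option Tree
  | some (.con c) => κ c
  | _ => none

/-- Simultaneous substitution of the trees `κ c` for the (nullary) constants `c` of a tree at which
`κ` is defined. -/
def treeSubstCon (κ : ℕ → Option Tree) : Tree → Tree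
  | t, [] => (eigenTree κ (t [])).elim (t []) (· [])
  | t, i :: w => (eigenTree κ (t [])).elim (treeSubstCon κ (fun v => t (i :: v)) w) (· (i :: w))

theorem treeSubstCon_eq_of_some {κ : ℕ → Option Tree} {t s : Tree} {c : ℕ}
    (h : t [] = some (.con c)) (hc : κ c = some s) : treeSubstCon κ t = s := by
  funext w
  cases w <;> simp [treeSubstCon, eigenTree, h, hc]

theorem treeSubstCon_nil_of_none {κ : ℕ → Option Tree} {t : Tree} {c : ℕ}
    (h : t [] = some (.con c)) (hc : κ c = none) : treeSubstCon κ t [] = some (.con c) := by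
  simp [treeSubstCon, eigenTree, h, hc]

theorem treeSubstCon_cons_of_none {κ : ℕ → Option Tree} {t : Tree} {c : ℕ}
    (h : t [] = some (.con c)) (hc : κ c = none) (i : ℕ) (w : List ℕ) :
    treeSubstCon κ t (i :: w) = treeSubstCon κ (fun v => t (i :: v)) w := by
  simp [treeSubstCon, eigenTree, h, hc]

theorem treeSubstCon_none (κ : ℕ → Option Tree) (w : List ℕ) :
    treeSubstCon κ (fun _ => none) w = none := by
  induction w with
  | nil => rfl
  | cons i w ih => exact ih

theorem treeSubstCon_const_none (t : Tree) : treeSubstCon (fun _ => none) t = t := by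
  have h : ∀ l, eigenTree (fun _ => none) l = none := by
    rintro (_ | _ | _ | _) <;> rfl
  funext w
  induction w generalizing t with
  | nil => simp [treeSubstCon, h]
  | cons i w ih => simpa [treeSubstCon, h] using ih _

/-- Unfolding commutes with substitution of terms for variables. -/
theorem treeSubstCon_treeOf_subst {S : Sig} {κ : ℕ → Option Tree}
    (hκ : ∀ c, S c ≠ none → κ c = none) (σ : ℕ → Tm) {ρ : Ty} {M : Tm} (hM : Regular S ρ M) :
    treeSubstCon κ (treeOf (subst σ M)) =
      treeSubst (fun i => treeSubstCon κ (treeOf (σ i))) (treeOf M) := by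
  funext w
  induction w generalizing ρ M with
  | nil =>
    rcases hM.unfold with ⟨-, x, hM⟩ | ⟨f, Ms, hM, hf, -⟩
    · rw [treeOf_congr (hM.subst σ), treeOf_congr hM, treeSubst_eq_of_var (treeOf_var_nil x)]
      rfl
    · rw [treeOf_congr (hM.subst σ), treeOf_congr hM, treeSubst_nil_of_con (treeOf_apps_nil f Ms),
        subst_apps]
      exact treeSubstCon_nil_of_none (treeOf_apps_nil _ _) (hκ f (by simp [hf]))
  | cons i w ih =>
    rcases hM.unfold with ⟨-, x, hM⟩ | ⟨f, Ms, hM, hf, hMs⟩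
    · rw [treeOf_congr (hM.subst σ), treeOf_congr hM, treeSubst_eq_of_var (treeOf_var_nil x)]
      rfl
    · rw [treeOf_congr (hM.subst σ), treeOf_congr hM,
        treeSubst_cons_of_con (treeOf_apps_nil f Ms), subst_apps, subst,
        treeSubstCon_cons_of_none (treeOf_apps_nil _ _) (hκ f (by simp [hf]))]
      by_cases hi : i < Ms.length
      · rw [treeOf_apps_subtree f hi, treeOf_apps_subtree f (by simpa using hi)]
        simpa using ih (hMs _ (List.getElem_mem hi))
      · simp only [treeOf_apps_cons_of_le f (not_lt.1 hi),
          treeOf_apps_cons_of_le f (Ms := Ms.map (subst σ)) (by simpa using hi)]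
        rw [treeSubst_none, treeSubstCon_none]

theorem treeSubst_treeOf_of_var (θ : ℕ → Tree) {S : Sig} {ρ : Ty} {M : Tm} (hM : Regular S ρ M)
    {w : List ℕ} {x : ℕ} (hx : treeOf M w = some (.var x)) :
    treeSubst θ (treeOf M) w = θ x [] := by
  induction w generalizing ρ M with
  | nil => rw [treeSubst_eq_of_var hx]
  | cons i w ih =>
    rcases hM.unfold with ⟨-, y, hM⟩ | ⟨f, Ms, hM, hf, hMs⟩
    · simp [treeOf_congr hM, treeOf_var_cons] at hx
    · rw [treeOf_congr hM] at hx ⊢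
      by_cases hi : i < Ms.length
      · rw [treeSubst_cons_of_con (treeOf_apps_nil f Ms), treeOf_apps_subtree f hi]
        rw [treeOf_apps_cons] at hx
        exact ih (hMs _ (List.getElem_mem hi)) (by simpa [hi] using hx)
      · simp [treeOf_apps_cons_of_le f (not_lt.1 hi)] at hx

/-- A substitution that fixes a term fixes the variables that occur in its tree, at least up to
unfolding. -/
theorem Regular.treeOf_subst_nil {S : Sig} {ρ : Ty} {M : Tm} (hM : Regular S ρ M) {σ : ℕ → Tm}
    (hσ : subst σ M = M) {w : List ℕ} {x : ℕ} (hx : treeOf M w = some (.var x)) :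
    treeOf (σ x) [] = some (.var x) := by
  have h := treeSubstCon_treeOf_subst (S := S) (κ := fun _ => none) (by simp) σ hM
  simp only [hσ, treeSubstCon_const_none] at h
  rw [← treeSubst_treeOf_of_var (fun i => treeOf (σ i)) hM hx, ← h, hx]

theorem Regular.lt_length_of_treeOf_eq_var {S S' : Sig} {ρ τ : Ty} {Γ : List Ty} {M : Tm}
    (hM : Regular S ρ M) (hτ : HasType S' Γ M τ) {w : List ℕ} {x : ℕ}
    (hx : treeOf M w = some (.var x)) : x < Γ.length := by
  by_contra hlt
  -- A variable outside the context would become the constant `0` in the tree of the same term.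
  have hσ : subst (fun i => if i < Γ.length then var i else cst 0) M = M := by
    rw [subst_congr_of_hasType hτ (σ' := var) (fun i hi => if_pos hi), subst_var]
  have h := hM.treeOf_subst_nil hσ hx
  rw [if_neg hlt] at h
  exact absurd (h.symm.trans (treeOf_apps_nil 0 [])) (by simp)

/-- Trees without variables. -/
def Ground (t : Tree) : Prop := ∀ w x, t w ≠ some (.var x)

/-- The tree of a closed term has no variables, since substituting a constant for them does not
change it. -/
theorem Regular.ground {S : Sig} {ρ : Ty} {M : Tm} (hM : Regular S ρ M) (hcl : M.Closed) :
    Ground (treeOf M) := fun _ _ hx =>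
  absurd ((hM.treeOf_subst_nil (hcl fun _ => cst 0) hx).symm.trans (treeOf_apps_nil 0 []))
    (by simp)

theorem Regular.treeSubst_eq_self {S : Sig} {ρ : Ty} {M : Tm} (hM : Regular S ρ M) (hcl : M.Closed)
    (θ : ℕ → Tree) : treeSubst θ (treeOf M) = treeOf M := by
  have h := treeSubstCon_treeOf_subst (S := S) (κ := fun _ => none) (by simp) (fun _ => cst 0) hM
  simp only [hcl _, treeSubstCon_const_none] at h
  conv_rhs => rw [h]
  exact treeSubst_congr fun w x hx => absurd hx (hM.ground hcl w x)

/-! ### Closed trees -/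

theorem Ty.arrows_inj {k k' : ℕ} {ρ ρ' : Ty} (hρ : ρ = .iota ∨ ρ = .o) (hρ' : ρ' = .iota ∨ ρ' = .o)
    (h : Ty.arrows k ρ = Ty.arrows k' ρ') : k = k' ∧ ρ = ρ' := by
  induction k generalizing k' with
  | zero =>
    cases k' with
    | zero => exact ⟨rfl, h⟩
    | succ k' => rcases hρ with rfl | rfl <;> simp [Ty.arrows] at h
  | succ k ih =>
    cases k' with
    | zero => rcases hρ' with rfl | rfl <;> simp [Ty.arrows] at h
    | succ k' =>
      obtain ⟨hk, hρ⟩ := ih (Ty.arr.inj h).2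
      exact ⟨congrArg _ hk, hρ⟩

/-- Coinduction principle for closed trees. -/
theorem IsClosedTree.of_coinduction {S : Sig} {R : Ty → Tree → Prop}
    (hR : ∀ ρ t, R ρ t → (ρ = .iota ∨ ρ = .o) ∧ ∃ c k, t [] = some (.con c) ∧
      S c = some (Ty.arrows k ρ) ∧ (∀ i < k, R .iota fun w => t (i :: w)) ∧
      ∀ i, k ≤ i → ∀ w, t (i :: w) = none)
    {ρ : Ty} {t : Tree} (h : R ρ t) : IsClosedTree S ρ t where
  root := by
    obtain ⟨-, c, k, hc, hk, -⟩ := hR _ _ h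
    exact ⟨c, k, hc, hk⟩
  node w i l hl := by
    obtain ⟨-, c, k, hc, hk, hlt, hle⟩ := hR _ _ h
    induction w generalizing ρ t c k with
    | nil =>
      by_cases hi : i < k
      · obtain ⟨-, c', k', hc', hk', -⟩ := hR _ _ (hlt i hi)
        exact ⟨c', k', Option.some.inj (hl.symm.trans hc'), hk'⟩
      · exact absurd (hle i (not_lt.1 hi) []) (by simp [show t [i] = some l from hl])
    | cons j w ih =>
      by_cases hj : j < k
      · obtain ⟨-, c', k', hc', hk', h₁, h₂⟩ := hR _ _ (hlt j hj)
        exact ih (hlt j hj) hl c' k' hc' hk' h₁ h₂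
      · simp [hle j (not_lt.1 hj)] at hl
  child w i := by
    obtain ⟨hρ, c, k, hc, hk, hlt, hle⟩ := hR _ _ h
    induction w generalizing ρ t c k with
    | nil =>
      constructor
      · intro hi
        refine ⟨c, k, ρ, hc, hρ, hk, ?_⟩
        by_contra hik
        have := hle i (not_lt.1 hik) []
        simp_all
      · rintro ⟨c', k', ρ', hc', hρ', hk', hi⟩
        obtain rfl : c = c' := by simpa [hc] using hc'
        obtain ⟨rfl, -⟩ := Ty.arrows_inj hρ hρ' (Option.some.inj (hk.symm.trans hk'))
        obtain ⟨-, c', k', hc', -⟩ := hR _ _ (hlt i hi)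
        simp [hc']
    | cons j w ih =>
      by_cases hj : j < k
      · obtain ⟨hρ', c', k', hc', hk', h₁, h₂⟩ := hR _ _ (hlt j hj)
        exact ih (hlt j hj) hρ' c' k' hc' hk' h₁ h₂
      · simp [hle j (not_lt.1 hj)]

theorem IsClosedTree.subtree {S : Sig} {ρ : Ty} {t : Tree} (h : IsClosedTree S ρ t)
    (hρ : ρ = .iota ∨ ρ = .o) {c k i : ℕ} (hc : t [] = some (.con c))
    (hk : S c = some (Ty.arrows k ρ)) (hi : i < k) :
    IsClosedTree S .iota fun w => t (i :: w) where
  root := by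
    have := (h.child [] i).2 ⟨c, k, ρ, hc, hρ, hk, hi⟩
    obtain ⟨l, hl⟩ := Option.isSome_iff_exists.1 this
    obtain ⟨c', k', rfl, hk'⟩ := h.node [] i l hl
    exact ⟨c', k', hl, hk'⟩
  node w j l hl := h.node (i :: w) j l hl
  child w j := h.child (i :: w) j

theorem IsClosedTree.eq_none_of_le {S : Sig} {ρ : Ty} {t : Tree} (h : IsClosedTree S ρ t)
    (hρ : ρ = .iota ∨ ρ = .o) {c k i : ℕ} (hc : t [] = some (.con c))
    (hk : S c = some (Ty.arrows k ρ)) (hi : k ≤ i) (w : List ℕ) : t (i :: w) = none := by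
  induction w using List.reverseRecOn with
  | nil =>
    by_contra hne
    obtain ⟨c', k', ρ', hc', hρ', hk', hi'⟩ := (h.child [] i).1 (Option.isSome_iff_ne_none.2 hne)
    obtain rfl : c = c' := by simpa [hc] using hc'
    obtain ⟨rfl, -⟩ := Ty.arrows_inj hρ hρ' (Option.some.inj (hk.symm.trans hk'))
    omega
  | append_singleton w j ih =>
    by_contra hne
    obtain ⟨c', k', ρ', hc', -⟩ := (h.child (i :: w) j).1 (Option.isSome_iff_ne_none.2 hne)
    simp [ih] at hc'

/-- `S'` extends `S` by eigenconstants of type `iota`, to which `κ` assigns closed trees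
over `S`. -/
structure IsValuation (S S' : Sig) (κ : ℕ → Option Tree) : Prop where
  old : ∀ c, κ c = none → S' c = S c
  new : ∀ c t, κ c = some t → S c = none ∧ S' c = some .iota ∧ t ∈ herbrandUniverse S

/-- A valuation leaves the constants of the original signature alone. -/
theorem IsValuation.eq_none {S S' : Sig} {κ : ℕ → Option Tree} (hκ : IsValuation S S' κ) (c : ℕ)
    (hc : S c ≠ none) : κ c = none := by
  by_contra h
  obtain ⟨t, ht⟩ := Option.ne_none_iff_exists'.1 h
  exact hc (hκ.new c t ht).1

theorem IsValuation.self (S : Sig) : IsValuation S S fun _ => none :=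
  ⟨fun _ _ => rfl, by simp⟩

/-- The value of a guarded term with ground tree, under a valuation of the eigenconstants, is a
closed tree over the original signature. -/
theorem Regular.isClosedTree {S S' : Sig} {κ : ℕ → Option Tree} (hκ : IsValuation S S' κ) {ρ : Ty}
    {M : Tm} (hM : Regular S' ρ M) (hg : Ground (treeOf M)) :
    IsClosedTree S ρ (treeSubstCon κ (treeOf M)) := by
  refine IsClosedTree.of_coinduction
    (R := fun ρ t => (ρ = .iota ∧ IsClosedTree S .iota t) ∨
      ∃ M, Regular S' ρ M ∧ Ground (treeOf M) ∧ t = treeSubstCon κ (treeOf M))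
    ?_ (.inr ⟨M, hM, hg, rfl⟩)
  have base : ∀ t, IsClosedTree S .iota t → ∃ c k, t [] = some (.con c) ∧
      S c = some (Ty.arrows k .iota) ∧ (∀ i < k, IsClosedTree S .iota fun w => t (i :: w)) ∧
      ∀ i, k ≤ i → ∀ w, t (i :: w) = none := by
    intro t ht
    obtain ⟨c, k, hc, hk⟩ := ht.root
    exact ⟨c, k, hc, hk, fun i hi => ht.subtree (.inl rfl) hc hk hi,
      fun i hi => ht.eq_none_of_le (.inl rfl) hc hk hi⟩
  rintro ρ t (⟨rfl, ht⟩ | ⟨M, hM, hg, rfl⟩)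
  · obtain ⟨c, k, hc, hk, h₁, h₂⟩ := base t ht
    exact ⟨.inl rfl, c, k, hc, hk, fun i hi => .inl ⟨rfl, h₁ i hi⟩, h₂⟩
  · refine ⟨hM.iota_or_o, ?_⟩
    rcases hM.unfold with ⟨-, x, hx⟩ | ⟨f, Ms, hM', hf, hMs⟩
    · exact absurd (by rw [treeOf_congr hx, treeOf_var_nil]) (hg [] x)
    · rw [treeOf_congr hM'] at hg ⊢
      have hnil := treeOf_apps_nil f Ms
      cases hκf : κ f with
      | some s =>
        obtain ⟨-, hf', hs⟩ := hκ.new f s hκf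
        obtain ⟨-, rfl⟩ := Ty.arrows_inj (k := 0) (.inl rfl) hM.iota_or_o
          (Option.some.inj (hf'.symm.trans hf))
        rw [treeSubstCon_eq_of_some hnil hκf]
        obtain ⟨c, k, hc, hk, h₁, h₂⟩ := base s hs
        exact ⟨c, k, hc, hk, fun i hi => .inl ⟨rfl, h₁ i hi⟩, h₂⟩
      | none =>
        refine ⟨f, Ms.length, treeSubstCon_nil_of_none hnil hκf, by rw [← hκ.old f hκf, hf],
          fun i hi => .inr ⟨Ms[i], hMs _ (List.getElem_mem hi), ?_, ?_⟩, fun i hi w => ?_⟩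
        · rw [← treeOf_apps_subtree f hi]
          exact fun w x => hg (i :: w) x
        · funext w
          rw [treeSubstCon_cons_of_none hnil hκf, treeOf_apps_subtree f hi]
        · rw [treeSubstCon_cons_of_none hnil hκf]
          simp only [treeOf_apps_cons_of_le f hi, treeSubstCon_none]

/-- If an instance of a regular tree is closed, so is the tree substituted for any variable that
occurs: it is a subtree of the instance. -/
theorem isClosedTree_of_treeSubst {S : Sig} {θ : ℕ → Tree} {ρ : Ty} {M : Tm} (hM : Regular S ρ M)
    (h : IsClosedTree S ρ (treeSubst θ (treeOf M))) {w : List ℕ} {x : ℕ}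
    (hx : treeOf M w = some (.var x)) : IsClosedTree S .iota (θ x) := by
  induction w generalizing ρ M with
  | nil =>
    rcases hM.unfold with ⟨rfl, -⟩ | ⟨f, Ms, hM', -⟩
    · rwa [treeSubst_eq_of_var hx] at h
    · simp [treeOf_congr hM', treeOf_apps_nil] at hx
  | cons i w ih =>
    rcases hM.unfold with ⟨-, y, hM'⟩ | ⟨f, Ms, hM', hf, hMs⟩
    · simp [treeOf_congr hM', treeOf_var_cons] at hx
    · rw [treeOf_congr hM'] at hx h
      have hnil := treeOf_apps_nil f Ms
      by_cases hi : i < Ms.length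
      · refine ih (hMs _ (List.getElem_mem hi)) ?_ (by simpa [treeOf_apps_cons, hi] using hx)
        have := h.subtree hM.iota_or_o (treeSubst_nil_of_con hnil) hf hi
        simpa only [treeSubst_cons_of_con hnil, treeOf_apps_subtree f hi] using this
      · simp [treeOf_apps_cons_of_le f (not_lt.1 hi)] at hx

/-- A term-form instance with guarded ground atoms is also a tree-form instance. A term substituted
for a variable that occurs in the tree of one of the atoms unfolds to a closed tree, namely to a
subtree of that atom's instance; terms substituted for other variables may have no tree at all,
and an arbitrary closed tree takes their place. -/
theorem exists_treeSubst_eq {S S' : Sig} {κ : ℕ → Option Tree} (hne : (herbrandUniverse S).Nonempty)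
    (hκ : IsValuation S S' κ) {As : List Tm} (hAs : ∀ A ∈ As, Regular S .o A) (σ : ℕ → Tm)
    (hσ : ∀ A ∈ As, Regular S' .o (subst σ A) ∧ Ground (treeOf (subst σ A))) :
    ∃ θ : ℕ → Tree, (∀ i, θ i ∈ herbrandUniverse S) ∧
      ∀ A ∈ As, treeSubst θ (treeOf A) = treeSubstCon κ (treeOf (subst σ A)) := by
  classical
  obtain ⟨t₀, ht₀⟩ := hne
  let val : ℕ → Tree := fun i => treeSubstCon κ (treeOf (σ i))
  refine ⟨fun i => if val i ∈ herbrandUniverse S then val i else t₀, fun i => ?_, fun A hA => ?_⟩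
  · dsimp only
    split_ifs with h
    · exact h
    · exact ht₀
  · have h := treeSubstCon_treeOf_subst hκ.eq_none σ (hAs A hA)
    rw [h]
    refine treeSubst_congr fun w x hx => if_pos ?_
    refine isClosedTree_of_treeSubst (θ := val) (hAs A hA) ?_ hx
    rw [← h]
    exact (hσ A hA).1.isClosedTree hκ (hσ A hA).2

/-! ### The shape of H-formulae under substitution and β-reduction -/

theorem Tm.IsAtomic.head {A : Tm} (h : A.IsAtomic) :
    (∃ c, A.head = cst c) ∨ ∃ i, A.head = var i := by
  rcases h with ⟨c, Ms, rfl⟩ | ⟨i, Ms, rfl⟩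
  · exact .inl ⟨c, head_apps _ _⟩
  · exact .inr ⟨i, head_apps _ _⟩

theorem not_isAtomic_of_head {A : Tm} {l : LCon} (h : A.head = log l) : ¬ A.IsAtomic := by
  intro hA
  rcases hA.head with ⟨c, hc⟩ | ⟨i, hi⟩ <;> simp_all

/-- Conjunctions of atoms, as they occur in the bodies of H-formulae. -/
inductive ConjOfAtoms : Tm → Prop
  | atom {A : Tm} : A.IsAtomic → ConjOfAtoms A
  | and {F G : Tm} : ConjOfAtoms F → ConjOfAtoms G → ConjOfAtoms (conj F G)

theorem Tm.AtomOf.eq_of_isAtomic {A B : Tm} (h : AtomOf A B) (hB : B.IsAtomic) : A = B := by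
  cases h with
  | self => rfl
  | _ => exact absurd hB (not_isAtomic_of_head rfl)

theorem atomOf_conj {A F G : Tm} (h : AtomOf A (conj F G)) : AtomOf A F ∨ AtomOf A G := by
  cases h with
  | self h => exact absurd h (not_isAtomic_of_head rfl)
  | andL _ h => exact .inl h
  | andR _ h => exact .inr h

theorem ConjOfAtoms.closed {F A : Tm} (hF : ConjOfAtoms F) (hcl : F.Closed) (hA : AtomOf A F) :
    A.Closed := by
  induction hF with
  | atom h => rwa [hA.eq_of_isAtomic h]
  | and _ _ ihF ihG =>
    rcases atomOf_conj hA with hA | hA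
    · exact ihF (fun σ => by simpa [subst] using (Tm.app.inj (hcl σ)).1) hA
    · exact ihG (fun σ => (Tm.app.inj (hcl σ)).2) hA

theorem atomOf_conjs {A : Tm} {As : List Tm} (hA : A ∈ As) (hat : A.IsAtomic) :
    AtomOf A (conjs As) := by
  induction As with
  | nil => simp at hA
  | cons B Bs ih =>
    cases Bs with
    | nil => rw [List.mem_singleton.1 hA]; exact .self (by rwa [← List.mem_singleton.1 hA])
    | cons C Cs =>
      rcases List.mem_cons.1 hA with rfl | hA
      · exact .andL _ (.self hat)
      · exact .andR _ (ih hA)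

theorem atomOf_alls {A F : Tm} (m : ℕ) (h : AtomOf A F) : AtomOf A (alls m F) := by
  induction m with
  | zero => exact h
  | succ m ih => exact .all ih

theorem HFormula.atomOf_toFormula {K : HFormula} {A : Tm} (hA : A ∈ K.atoms) (hat : A.IsAtomic) :
    AtomOf A K.toFormula := by
  refine atomOf_alls _ ?_
  unfold matrix
  rcases List.mem_cons.1 hA with rfl | hA
  · cases K.body with
    | nil => exact .self hat
    | cons B Bs => exact .impR _ (.self hat)
  · cases hb : K.body with
    | nil => simp [hb] at hA
    | cons B Bs => exact .impL _ (atomOf_conjs (hb ▸ hA) hat)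

theorem subst_alls (σ : ℕ → Tm) (m : ℕ) (F : Tm) :
    subst σ (alls m F) = alls m (subst (up^[m] σ) F) := by
  induction m generalizing σ with
  | zero => rfl
  | succ m ih => simp [alls, subst, ih]

/-- `M` reduces to `N` in finitely many β-steps. -/
abbrev BetaRed : Tm → Tm → Prop := Relation.ReflTransGen BetaStep

theorem BetaRed.subst {M N : Tm} (h : BetaRed M N) (σ : ℕ → Tm) :
    BetaRed (Tm.subst σ M) (Tm.subst σ N) :=
  h.lift _ fun _ _ h => h.subst σ

theorem BetaRed.fixBetaEq {M N : Tm} (h : BetaRed M N) : FixBetaEq M N := by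
  induction h with
  | refl => exact .refl _
  | tail _ h ih => exact ih.trans (.of_beta h)

theorem BetaRed.isRigid {M N : Tm} (h : BetaRed M N) (hM : M.IsRigid) : N.IsRigid := by
  obtain ⟨c, Ms, rfl⟩ := hM
  obtain ⟨Ns, rfl, -⟩ :=
    apps_cst_of_reflTransGen_par (Relation.ReflTransGen.mono (fun _ _ => BetaStep.par) _ _ h)
  exact ⟨c, Ns, rfl⟩

theorem BetaRed.log_app_app {l : LCon} {F G M : Tm} (h : BetaRed (app (app (log l) F) G) M) :
    ∃ F' G', M = app (app (log l) F') G' ∧ BetaRed F F' ∧ BetaRed G G' := by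
  induction h with
  | refl => exact ⟨F, G, rfl, .refl, .refl⟩
  | tail _ h ih =>
    obtain ⟨F', G', rfl, hF, hG⟩ := ih
    cases h with
    | appL _ h =>
      cases h with
      | appL _ h => cases h
      | appR _ h => exact ⟨_, _, rfl, hF.tail h, hG⟩
    | appR _ h => exact ⟨_, _, rfl, hF, hG.tail h⟩

theorem BetaRed.alls {m : ℕ} {F M : Tm} (h : BetaRed (alls m F) M) :
    ∃ F', M = CUP.alls m F' ∧ BetaRed F F' := by
  induction m generalizing M with
  | zero => exact ⟨M, rfl, h⟩
  | succ m ih =>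
    have : ∃ E, M = all .iota E ∧ BetaRed (CUP.alls m F) E := by
      clear ih
      induction h with
      | refl => exact ⟨_, rfl, .refl⟩
      | tail _ h ih =>
        obtain ⟨E, rfl, hE⟩ := ih
        cases h with
        | appL _ h => cases h
        | appR _ h => cases h with
          | lam h => exact ⟨_, rfl, hE.tail h⟩
    obtain ⟨E, rfl, hE⟩ := this
    obtain ⟨F', rfl, hF⟩ := ih hE
    exact ⟨F', rfl, hF⟩

theorem Tm.IsRigid.subst {A : Tm} (h : A.IsRigid) (σ : ℕ → Tm) : (Tm.subst σ A).IsRigid := by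
  obtain ⟨c, Ms, rfl⟩ := h
  exact ⟨c, _, subst_apps _ _ _⟩

/-- A β-reduct of an instance of a non-empty conjunction of rigid atoms is a conjunction of
reducts of the instances of these atoms. -/
theorem BetaRed.conjs {As : List Tm} (hne : As ≠ []) (hAs : ∀ A ∈ As, A.IsRigid) {σ : ℕ → Tm}
    {G : Tm} (h : BetaRed (Tm.subst σ (conjs As)) G) :
    ConjOfAtoms G ∧ ∀ A ∈ As, ∃ B, AtomOf B G ∧ FixBetaEq (Tm.subst σ A) B := by
  induction As generalizing G with
  | nil => exact absurd rfl hne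
  | cons A As ih =>
    have hA : (Tm.subst σ A).IsRigid := (hAs A (.head _)).subst σ
    cases As with
    | nil =>
      have hG := BetaRed.isRigid h hA
      refine ⟨.atom (.inl hG), fun B hB => ⟨G, .self (.inl hG), ?_⟩⟩
      rw [List.mem_singleton.1 hB]
      exact BetaRed.fixBetaEq h
    | cons A' As =>
      obtain ⟨F', G', rfl, hF, hG⟩ := BetaRed.log_app_app h
      have hF' := BetaRed.isRigid hF hA
      obtain ⟨h₁, h₂⟩ := ih (by simp) (fun B hB => hAs B (.tail _ hB)) hG
      refine ⟨.and (.atom (.inl hF')) h₁, fun B hB => ?_⟩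
      rcases List.mem_cons.1 hB with rfl | hB
      · exact ⟨F', .andL _ (.self (.inl hF')), hF.fixBetaEq⟩
      · obtain ⟨C, hC, hBC⟩ := h₂ B hB
        exact ⟨C, .andR _ hC, hBC⟩

/-! ### Soundness of the proof rules -/

/-- The value of an atom under a valuation of the eigenconstants. -/
noncomputable def value (κ : ℕ → Option Tree) (A : Tm) : Tree := treeSubstCon κ (treeOf A)

theorem value_congr {κ : ℕ → Option Tree} {A B : Tm} (h : FixBetaEq A B) :
    value κ A = value κ B := by
  rw [value, treeOf_congr h, value]

theorem value_subst {S S' : Sig} {κ : ℕ → Option Tree} (hκ : IsValuation S S' κ) (σ : ℕ → Tm)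
    {ρ : Ty} {A : Tm} (hA : Regular S ρ A) :
    value κ (subst σ A) = treeSubst (fun i => value κ (σ i)) (treeOf A) :=
  treeSubstCon_treeOf_subst hκ.eq_none σ hA

/-- Closed formulae with guarded atoms. -/
def Admissible (S : Sig) (F : Tm) : Prop := F.Closed ∧ ∀ A, AtomOf A F → GuardedAtom S A

/-- Truth of a program clause: if the atoms in its bodies have values in `X`, then its heads have
values in `Y`. As in proofs, only instances that are closed and guarded matter. -/
inductive Holds (S : Sig) (κ : ℕ → Option Tree) (X Y : Set Tree) : Tm → Prop
  | atom {A : Tm} : A.IsAtomic → (Admissible S A → value κ A ∈ Y) → Holds S κ X Y A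
  | and {D E : Tm} : Holds S κ X Y D → Holds S κ X Y E → Holds S κ X Y (conj D E)
  | imp {G D : Tm} : ConjOfAtoms G →
      (Admissible S (impl G D) → (∀ A, AtomOf A G → value κ A ∈ X) → Holds S κ X Y D) →
      Holds S κ X Y (impl G D)
  | all {τ : Ty} {D : Tm} : (∀ N D', BetaNF (inst D N) D' → Holds S κ X Y D') →
      Holds S κ X Y (all τ D)

theorem Holds.mono {S : Sig} {κ : ℕ → Option Tree} {X Y Z : Set Tree} (hYZ : Y ⊆ Z) {D : Tm}
    (h : Holds S κ X Y D) : Holds S κ X Z D := by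
  induction h with
  | atom hA h => exact .atom hA fun ha => hYZ (h ha)
  | and _ _ ihD ihE => exact .and ihD ihE
  | imp hG _ ih => exact .imp hG ih
  | all _ ih => exact .all ih

theorem holds_subst_conjs {S : Sig} {κ : ℕ → Option Tree} {X Y : Set Tree} {σ : ℕ → Tm}
    {As : List Tm} (hne : As ≠ []) (hAs : ∀ A ∈ As, A.IsRigid)
    (h : ∀ A ∈ As, value κ (subst σ A) ∈ Y) : Holds S κ X Y (subst σ (conjs As)) := by
  have hatom : ∀ A ∈ As, Holds S κ X Y (subst σ A) := fun A hA =>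
    .atom (.inl ((hAs A hA).subst σ)) fun _ => h A hA
  clear hAs h
  induction As with
  | nil => exact absurd rfl hne
  | cons A As ih =>
    cases As with
    | nil => exact hatom A (.head _)
    | cons B Bs =>
      exact .and (hatom A (.head _)) (ih (by simp) fun C hC => hatom C (.tail _ hC))

/-- What a sequent over `S` says when the conclusions of unguarded goals are to lie in `X` and those
of guarded atomic goals in `Y`. A focused sequent transfers the truth of the focused clause, for
any target set `Z`, to its atom. -/
def Sound (S : Sig) (κ : ℕ → Option Tree) (X Y : Set Tree) : Sequent → Prop
  | .goal S' Δ G => S' = S → (∀ D ∈ Δ, Holds S κ X X D) → ConjOfAtoms G →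
      ∀ A, AtomOf A G → value κ A ∈ X
  | .focus S' Δ D A => S' = S → (∀ D ∈ Δ, Holds S κ X X D) →
      ∀ Z, Holds S κ X Z D → value κ A ∈ Z
  | .ggoal S' Δ A => S' = S → (∀ D ∈ Δ, Holds S κ X X D) → A.IsAtomic → value κ A ∈ Y
  | .gfocus S' Δ D A => S' = S → (∀ D ∈ Δ, Holds S κ X X D) →
      ∀ Z, Holds S κ X Z D → value κ A ∈ Z
  | .coind _ _ => True

/-- Soundness. In a guarded atomic goal only a clause of `C` can be selected, and these have their
heads in `Y`; everywhere else the weaker target `X` suffices, and there the clauses of `Δ`, which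
are true in `X`, are available too. -/
theorem Proof.sound {C : Set Tm} {S : Sig} {κ : ℕ → Option Tree} {X Y : Set Tree} (hYX : Y ⊆ X)
    (hC : ∀ D ∈ C, Holds S κ X Y D) {s : Sequent}
    (h : Proof C (fun s => s.InCoHohh C ∧ s.OnlyGuarded C) s) : Sound S κ X Y s := by
  have hCX : ∀ {Δ : Set Tm}, (∀ D ∈ Δ, Holds S κ X X D) → ∀ D ∈ C ∪ Δ, Holds S κ X X D :=
    fun hΔ D hD => hD.elim (fun hD => (hC D hD).mono hYX) (hΔ D)
  have adm : ∀ {s : Sequent} {D : Tm}, s.InCoHohh C ∧ s.OnlyGuarded C → D ∈ s.clauses C →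
      Admissible s.sig D :=
    fun hQ hD => ⟨.of_hasType (hQ.1.1 _ hD).2.1, hQ.2.1 _ hD⟩
  induction h with
  | impR | allR | exR | orR₁ | orR₂ | topR =>
    rintro - - hG
    cases hG with
    | atom hG => exact absurd hG (not_isAtomic_of_head rfl)
  | andR _ _ _ ih₁ ih₂ =>
    intro hS hΔ hG A hA
    cases hG with
    | atom hG => exact absurd hG (not_isAtomic_of_head rfl)
    | and h₁ h₂ =>
      rcases atomOf_conj hA with hA | hA
      · exact ih₁ hS hΔ h₁ A hA
      · exact ih₂ hS hΔ h₂ A hA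
  | decide D _ hat hD _ ih =>
    intro hS hΔ _ A hA
    rw [hA.eq_of_isAtomic hat]
    exact ih hS hΔ X (hCX hΔ D hD)
  | impL hQ _ _ _ ihD ihG | gimpL hQ _ _ _ ihD ihG =>
    intro hS hΔ Z hZ
    cases hZ with
    | atom h => exact absurd h (not_isAtomic_of_head rfl)
    | imp hG h =>
      subst hS
      exact ihD rfl hΔ Z (h (adm hQ (by simp [Sequent.clauses])) (ihG rfl hΔ hG))
  | andL₁ _ _ _ ih | gandL₁ _ _ _ ih =>
    intro hS hΔ Z hZ
    cases hZ with
    | atom h => exact absurd h (not_isAtomic_of_head rfl)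
    | and h _ => exact ih hS hΔ Z h
  | andL₂ _ _ _ ih | gandL₂ _ _ _ ih =>
    intro hS hΔ Z hZ
    cases hZ with
    | atom h => exact absurd h (not_isAtomic_of_head rfl)
    | and _ h => exact ih hS hΔ Z h
  | allL N _ _ _ hN _ ih | gallL N _ _ _ hN _ ih =>
    intro hS hΔ Z hZ
    cases hZ with
    | atom h => exact absurd h (not_isAtomic_of_head rfl)
    | all h => exact ih hS hΔ Z (h N _ hN)
  | initial hQ hat _ heq | ginitial hQ hat _ heq =>
    intro hS hΔ Z hZ
    subst hS
    rw [value_congr heq]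
    cases hZ with
    | atom _ h => exact h (adm hQ (by simp [Sequent.clauses]))
    | _ => exact absurd hat (not_isAtomic_of_head rfl)
  | cofix => trivial
  | gimpR | gallR | gandR =>
    intro _ _ h
    exact absurd h (not_isAtomic_of_head rfl)
  | gdecide D _ _ hD _ ih =>
    intro hS hΔ _
    exact ih hS hΔ Y (hC D hD)

/-- The clause of an H-formula holds if all its term-form instances with guarded ground
atoms do. -/
theorem HFormula.holds_toFormula {S : Sig} {κ : ℕ → Option Tree} {X Y : Set Tree} {K : HFormula}
    (hK : ∀ A ∈ K.atoms, A.IsRigid)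
    (h : ∀ σ : ℕ → Tm,
      (∀ A ∈ K.atoms, Regular S .o (subst σ A) ∧ Ground (treeOf (subst σ A))) →
      (∀ A ∈ K.body, value κ (subst σ A) ∈ X) → value κ (subst σ K.head) ∈ Y) :
    Holds S κ X Y K.toFormula := by
  have good : ∀ {A B : Tm}, FixBetaEq A B → B.IsAtomic → B.Closed → GuardedAtom S B →
      Regular S .o A ∧ Ground (treeOf A) := by
    intro A B hAB hB hcl hg
    have hr := GuardedAtom.regular hg
    exact ⟨hr.congr hAB, by rw [treeOf_congr hAB]; exact hr.ground hcl⟩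
  -- Quantifiers already instantiated are recorded in `σ`, and `m` remain; `F` is only a reduct of
  -- the substituted matrix because every instantiation is followed by β-normalization.
  have key : ∀ (m : ℕ) (σ : ℕ → Tm) (F : Tm), BetaRed (subst (up^[m] σ) K.matrix) F →
      Holds S κ X Y (alls m F) := by
    intro m
    induction m with
    | zero =>
      intro σ F hF
      have hhead := (hK K.head (.head _)).subst σ
      unfold matrix at hF
      cases hb : K.body with
      | nil =>
        rw [hb] at hF
        have hF' := BetaRed.isRigid hF hhead
        have heq := BetaRed.fixBetaEq hF
        refine .atom (.inl hF') fun hadm => ?_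
        rw [alls, ← value_congr heq]
        refine h σ (fun A hA => ?_) (by simp [hb])
        obtain rfl : A = K.head := by simpa [atoms, hb] using hA
        exact good heq (.inl hF') hadm.1 (hadm.2 _ (.self (.inl hF')))
      | cons B Bs =>
        rw [hb] at hF
        obtain ⟨G', A', rfl, hG, hA'⟩ := BetaRed.log_app_app hF
        obtain ⟨hG', hGB⟩ := BetaRed.conjs (by simp)
          (fun A hA => hK A (.tail _ (hb ▸ hA))) hG
        have hat := BetaRed.isRigid hA' hhead
        have heq := BetaRed.fixBetaEq hA'
        refine .imp hG' fun hadm hX => .atom (.inl hat) fun hadm' => ?_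
        rw [← value_congr heq]
        refine h σ (fun A hA => ?_) (fun A hA => ?_)
        · rcases List.mem_cons.1 hA with rfl | hA
          · exact good heq (.inl hat) hadm'.1 (hadm'.2 _ (.self (.inl hat)))
          · obtain ⟨C, hC, hAC⟩ := hGB A (hb ▸ hA)
            have hCl : G'.Closed := fun σ =>
              (Tm.app.inj (Tm.app.inj (hadm.1 σ)).1).2
            have hg := hadm.2 C (.impL _ hC)
            exact good hAC hg.1 (hG'.closed hCl hC) hg
        · obtain ⟨C, hC, hAC⟩ := hGB A (hb ▸ hA)
          exact (value_congr (κ := κ) hAC).symm ▸ hX C hC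
    | succ m ih =>
      intro σ F hF
      refine .all fun N D' hD' => ?_
      rw [inst_eq_subst, subst_alls] at hD'
      obtain ⟨F', rfl, hF'⟩ := BetaRed.alls hD'.1
      refine ih (fun i => subst (single N) (up σ i)) F' (.trans ?_ hF')
      have := BetaRed.subst hF (up^[m] (single N))
      simp only [subst_subst, Function.iterate_succ_apply, subst_iterate_up] at this
      exact this
  refine key K.arity var K.matrix ?_
  rw [iterate_up_var, subst_var]

/-- Removing the universal quantifiers of a guarded goal: the eigenconstants can be given arbitrary
trees as values. -/
theorem Proof.exists_of_ggoal_alls {C : Set Tm} {Q : Sequent → Prop} {S : Sig} {θ : ℕ → Tree}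
    {Δ : Set Tm} (m : ℕ) (hθ : ∀ i < m, θ i ∈ herbrandUniverse S) {S' : Sig}
    {κ : ℕ → Option Tree} (hκ : IsValuation S S' κ) {F : Tm}
    (h : Proof C Q (.ggoal S' Δ (alls m F))) :
    ∃ S'' κ', ∃ σ : ℕ → Tm, IsValuation S S'' κ' ∧ (∀ c t, κ c = some t → κ' c = some t) ∧
      (∀ i < m, ∃ c, σ i = cst c ∧ κ' c = some (θ i)) ∧
      Proof C Q (.ggoal S'' Δ (subst σ F)) := by
  classical
  induction m generalizing S' κ F with
  | zero => exact ⟨S', κ, var, hκ, fun _ _ => id, by simp, by rwa [subst_var]⟩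
  | succ m ih =>
    cases h with
    | gdecide _ _ hat => exact absurd hat (not_isAtomic_of_head rfl)
    | gallR c _ hc h =>
      have hκc : κ c = none := by
        by_contra hne
        obtain ⟨t, ht⟩ := Option.ne_none_iff_exists'.1 hne
        simp [(hκ.new c t ht).2.1] at hc
      have hκ' : IsValuation S (Function.update S' c (some .iota))
          (Function.update κ c (some (θ m))) := by
        constructor
        · intro d hd
          by_cases hdc : d = c
          · simp [hdc] at hd
          · rw [Function.update_of_ne hdc] at hd ⊢
            exact hκ.old d hd
        · intro d t hd
          by_cases hdc : d = c
          · subst hdc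
            simp only [Function.update_self, Option.some.injEq] at hd ⊢
            exact ⟨by rw [← hκ.old d hκc, hc], trivial, hd ▸ hθ m (Nat.lt_succ_self m)⟩
          · rw [Function.update_of_ne hdc] at hd ⊢
            exact hκ.new d t hd
      rw [inst_eq_subst, subst_alls] at h
      obtain ⟨S'', κ', σ, hκ'', hext, hσ, hp⟩ := ih (fun i hi => hθ i (by omega)) hκ' h
      rw [subst_subst] at hp
      refine ⟨S'', κ', _, hκ'', fun d t hd => hext d t ?_, fun i hi => ?_, hp⟩
      · rw [Function.update_of_ne (fun hdc => by simp [hdc, hκc] at hd), hd]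
      · rcases Nat.lt_succ_iff_lt_or_eq.1 hi with hi | rfl
        · simpa only [iterate_up_lt _ hi, subst] using hσ i hi
        · have := iterate_up_add (single (cst c)) i 0
          simp only [Nat.add_zero] at this
          exact ⟨c, by simp [this, single, rename, subst], hext c _ (by simp)⟩

/-! ### Conservativity -/

theorem consequence_mono {S : Sig} {P P' : Set HFormula} (h : P ⊆ P') (I : Set Tree) :
    consequence S P I ⊆ consequence S P' I :=
  fun _ ⟨hB, K, hK, hr⟩ => ⟨hB, K, h hK, hr⟩

/-- The value of the head of a term-form instance with guarded ground atoms is an immediate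
consequence of the values of the body. -/
theorem value_mem_consequence {S S' : Sig} {κ : ℕ → Option Tree}
    (hne : (herbrandUniverse S).Nonempty) (hκ : IsValuation S S' κ) {P : Set HFormula}
    {K : HFormula} (hKP : K ∈ P) (hK : ∀ A ∈ K.atoms, Regular S .o A) {X : Set Tree} {σ : ℕ → Tm}
    (hσ : ∀ A ∈ K.atoms, Regular S' .o (subst σ A) ∧ Ground (treeOf (subst σ A)))
    (hX : ∀ A ∈ K.body, value κ (subst σ A) ∈ X) :
    value κ (subst σ K.head) ∈ consequence S P X := by
  obtain ⟨θ, hθ, h⟩ := exists_treeSubst_eq hne hκ hK σ hσ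
  have hhead := hσ K.head (.head _)
  refine ⟨hhead.1.isClosedTree hκ hhead.2, K, hKP, θ, fun i _ => hθ i,
    ⟨_, (hK _ (.head _)).isTreeOf, h _ (.head _)⟩, fun A hA => ⟨_, (hK A (.tail _ hA)).isTreeOf, ?_⟩⟩
  rw [h A (.tail _ hA)]
  exact hX A hA

theorem GuardedCoHohhProvable.regular {S : Sig} {C : Set Tm} {M : Tm}
    (h : GuardedCoHohhProvable S C M) {K : HFormula} (hK : K.WellFormed S)
    (hKC : K.toFormula ∈ C ∪ {M}) : ∀ A ∈ K.atoms, Regular S .o A := by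
  cases (show Proof _ _ _ from h) with
  | cofix hQ _ =>
    exact fun A hA =>
      GuardedAtom.regular (hQ.2.1 _ hKC A (K.atomOf_toFormula hA (.inl (hK A hA).2.1)))

/-- The step that a guarded proof makes before it may use the coinduction hypothesis: if `X` is
closed under the rules of `P` and of `H`, then whatever `H` yields from `X` is already yielded by
a rule of `P`. -/
theorem consequence_singleton_subset {S : Sig} (hne : (herbrandUniverse S).Nonempty)
    {P : Set HFormula} (hP : ∀ K ∈ P, K.WellFormed S) {H : HFormula} (hH : H.WellFormed S)
    (hproof : GuardedCoHohhProvable S (HFormula.toFormula '' P) H.toFormula) {X : Set Tree}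
    (hPX : consequence S P X ⊆ X) (hHX : consequence S {H} X ⊆ X) :
    consequence S {H} X ⊆ consequence S P X := by
  have hregP : ∀ K ∈ P, ∀ A ∈ K.atoms, Regular S .o A := fun K hK =>
    hproof.regular (hP K hK) (.inl ⟨K, hK, rfl⟩)
  have hregH : ∀ A ∈ H.atoms, Regular S .o A := hproof.regular hH (.inr rfl)
  cases (show Proof _ _ _ from hproof) with
  | cofix _ hproof =>
  rintro B ⟨-, K, hKH, θ, hθ, ⟨t, ht, rfl⟩, hbody⟩
  obtain rfl : H = K := hKH.symm
  obtain rfl := ht.eq_treeOf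
  obtain ⟨S', κ, σ, hκ, -, hσ, h⟩ :=
    Proof.exists_of_ggoal_alls _ hθ (IsValuation.self S) hproof
  -- The instance of `H` with the eigenconstants has the same value as the given tree instance.
  have hval : ∀ A ∈ H.atoms, value κ (subst σ A) = treeSubst θ (treeOf A) := by
    intro A hA
    rw [value_subst hκ σ (hregH A hA)]
    refine treeSubst_congr fun w x hx => ?_
    have hlt := (hregH A hA).lt_length_of_treeOf_eq_var (hH A hA).1 hx
    rw [List.length_replicate] at hlt
    obtain ⟨c, hc, hκc⟩ := hσ x hlt
    rw [hc]
    exact treeSubstCon_eq_of_some (treeOf_apps_nil c []) hκc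
  have hvalX : ∀ A ∈ H.body, value κ (subst σ A) ∈ X := by
    intro A hA
    obtain ⟨t, ht, htX⟩ := hbody A hA
    obtain rfl := ht.eq_treeOf
    rwa [hval A (.tail _ hA)]
  rw [← hval H.head (.head _)]
  have hC : ∀ D ∈ HFormula.toFormula '' P, Holds S' κ X (consequence S P X) D := by
    rintro _ ⟨K, hK, rfl⟩
    exact K.holds_toFormula (fun A hA => (hP K hK A hA).2.1) fun τ hτ hX =>
      value_mem_consequence hne hκ hK (hregP K hK) hτ hX
  have hholdsH : Holds S' κ X X H.toFormula :=
    H.holds_toFormula (fun A hA => (hH A hA).2.1) fun τ hτ hX =>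
      hHX (value_mem_consequence hne hκ (Set.mem_singleton H) hregH hτ hX)
  have hat : (subst σ H.head).IsAtomic := .inl (((hH H.head (.head _)).2.1).subst σ)
  unfold HFormula.matrix at h
  cases hb : H.body with
  | nil =>
    rw [hb] at h
    refine h.sound hPX hC rfl ?_ hat
    rintro D rfl
    exact hholdsH
  | cons A As =>
    rw [hb] at h
    cases h with
    | gdecide _ _ hat' => exact absurd hat' (not_isAtomic_of_head rfl)
    | gimpR _ h =>
      refine h.sound hPX hC rfl ?_ hat
      rintro D (rfl | rfl)
      · exact holds_subst_conjs (by simp) (fun B hB => (hH B (.tail _ (hb ▸ hB))).2.1)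
          fun B hB => hvalX B (hb ▸ hB)
      · exact hholdsH

/-- All tree-form instances of a coinductively proved `H` may be added as rules: the model of the
larger program is a post-fixed point of the operator of `P`. -/
theorem coinductiveModel_union_singleton_subset {S : Sig} (hne : (herbrandUniverse S).Nonempty)
    {P : Set HFormula} (hP : ∀ K ∈ P, K.WellFormed S) {H : HFormula} (hH : H.WellFormed S)
    (hproof : GuardedCoHohhProvable S (HFormula.toFormula '' P) H.toFormula) :
    coinductiveModel S (P ∪ {H}) ⊆ coinductiveModel S P := by
  have hfix : consequence S (P ∪ {H}) (coinductiveModel S (P ∪ {H})) =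
      coinductiveModel S (P ∪ {H}) := OrderHom.map_gfp _
  have hsub : ∀ P' ⊆ P ∪ {H}, consequence S P' (coinductiveModel S (P ∪ {H})) ⊆
      coinductiveModel S (P ∪ {H}) := fun P' hP' =>
    (consequence_mono hP' _).trans hfix.subset
  have hkey := consequence_singleton_subset hne hP hH hproof
    (hsub P Set.subset_union_left) (hsub {H} Set.subset_union_right)
  refine OrderHom.le_gfp _ fun B hB => ?_
  rw [← hfix] at hB
  obtain ⟨hB, K, hK | hK, hr⟩ := hB
  · exact ⟨hB, K, hK, hr⟩
  · exact hkey ⟨hB, K, hK, hr⟩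

/-- A rule that is a term-form instance of `H` with guarded atoms yields nothing that tree-form
instances of `H` do not yield. -/
theorem consequence_singleton_subset_of_isTermInstance {S : Sig}
    (hne : (herbrandUniverse S).Nonempty) {H H' : HFormula} (hH : H.WellFormed S)
    (hreg : ∀ A ∈ H.atoms, Regular S .o A) (hinst : H.IsTermInstance S H')
    (hguarded : ∀ A ∈ H'.atoms, GuardedAtom S A) (I : Set Tree) :
    consequence S {H'} I ⊆ consequence S {H} I := by
  obtain ⟨σ, hσ, rfl⟩ := hinst
  have hσ' : ∀ A ∈ H.atoms, Regular S .o (subst σ A) ∧ (subst σ A).Closed := by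
    intro A hA
    refine ⟨GuardedAtom.regular (hguarded _ ?_), fun τ => ?_⟩
    · rcases List.mem_cons.1 hA with rfl | hA
      · exact .head _
      · exact .tail _ (List.mem_map_of_mem hA)
    · rw [subst_subst]
      refine subst_congr_of_hasType (hH A hA).1 fun i hi => ?_
      exact Closed.of_hasType (hσ i (by simpa using hi)).1 τ
  obtain ⟨θ', hθ', h'⟩ := exists_treeSubst_eq hne (IsValuation.self S) hreg σ
    fun A hA => ⟨(hσ' A hA).1, (hσ' A hA).1.ground (hσ' A hA).2⟩
  simp only [treeSubstCon_const_none] at h'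
  rintro B ⟨hB, K, hK, θ, -, ⟨t, ht, rfl⟩, hbody⟩
  rw [Set.mem_singleton_iff] at hK
  subst hK
  have heq : ∀ A ∈ H.atoms, ∀ t, IsTreeOf (subst σ A) t →
      treeSubst θ t = treeSubst θ' (treeOf A) := by
    intro A hA t ht
    rw [ht.eq_treeOf, h' A hA, (hσ' A hA).1.treeSubst_eq_self (hσ' A hA).2]
  refine ⟨hB, H, rfl, θ', fun i _ => hθ' i,
    ⟨_, (hreg _ (.head _)).isTreeOf, (heq _ (.head _) t ht).symm⟩,
    fun A hA => ⟨_, (hreg _ (.tail _ hA)).isTreeOf, ?_⟩⟩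
  obtain ⟨t, ht, htI⟩ := hbody _ (List.mem_map_of_mem hA)
  rwa [← heq A (.tail _ hA) t ht]

end CUP

theorem mainTheorem2
    (S : CUP.Sig) (hS : S.FirstOrder) (hne : (CUP.herbrandUniverse S).Nonempty)
    (P : Set CUP.HFormula) (hP : CUP.IsProgram S P)
    (H : CUP.HFormula) (hH : H.WellFormed S)
    (hproof : CUP.GuardedCoHohhProvable S (CUP.HFormula.toFormula '' P) H.toFormula)
    (n : ℕ) (Hs : Fin n → CUP.HFormula) (hdistinct : Function.Injective Hs)
    (hinst : ∀ k, H.IsTermInstance S (Hs k))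
    (hguarded : ∀ k, ∀ A ∈ (Hs k).atoms, CUP.Tm.GuardedAtom S A)
    (hbody : ∀ k, ∀ A ∈ (Hs k).body,
      ∃ t, CUP.IsTreeOf A t ∧ t ∈ CUP.coinductiveModel S P) :
    CUP.coinductiveModel S (P ∪ Set.range Hs) = CUP.coinductiveModel S P := by
  apply Set.Subset.antisymm
  · refine Set.Subset.trans ?_
      (CUP.coinductiveModel_union_singleton_subset hne hP.2 hH hproof)
    have hreg := hproof.regular hH (.inr rfl)
    refine OrderHom.le_gfp _ fun B hB => ?_
    have hfix : CUP.consequence S (P ∪ Set.range Hs) (CUP.coinductiveModel S (P ∪ Set.range Hs)) =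
        CUP.coinductiveModel S (P ∪ Set.range Hs) := OrderHom.map_gfp _
    change B ∈ CUP.coinductiveModel S (P ∪ Set.range Hs) at hB
    rw [← hfix] at hB
    obtain ⟨hB, K, hK | ⟨k, rfl⟩, hr⟩ := hB
    · exact ⟨hB, K, .inl hK, hr⟩
    · exact CUP.consequence_mono Set.subset_union_right _
        (CUP.consequence_singleton_subset_of_isTermInstance hne hH hreg (hinst k) (hguarded k) _
          ⟨hB, Hs k, rfl, hr⟩)
  · refine OrderHom.le_gfp _ fun B hB => ?_
    have hfix : CUP.consequence S P (CUP.coinductiveModel S P) = CUP.coinductiveModel S P :=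
      OrderHom.map_gfp _
    change B ∈ CUP.coinductiveModel S P at hB
    rw [← hfix] at hB
    exact CUP.consequence_mono Set.subset_union_left _ hB
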